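/- **Conventions.** Let $\mathbb F=\mathbb R$ or $\mathbb C$. An operator space $\mathcal W$ over $\mathbb F$ is a vector space with Banach space norms $\|\cdot\|_n$ on $\mathcal W^{n\times n}$, $n\ge 1$, such that $\|X\oplus Y\|_{n+m}=\max\{\|X\|_n,\|Y\|_m\}$ and $\|SXT\|_n\le\|S\|\,\|X\|_n\,\|T\|$ for $S,T\in\mathbb F^{n\times n}$ with the $(2,2)$ operator norm. The product $\mathcal X\times\mathcal Y$ carries the norms $\|(X,Y)\|_n=\max\{\|X\|_n,\|Y\|_n\}$. Put $\mathcal W_{\rm nc}=\coprod_{n\ge1}\mathcal W^{n\times n}$, $\Omega_n=\Omega\cap\mathcal W^{n\times n}$ for $\Omega\subseteq\mathcal W_{\rm nc}$, and $Y^{(m)}=Y\oplus\cdots\oplus Y$ ($m$ summands). For $Y\in\mathcal W^{s\times s}$ and $r>0$ let $B(Y^{(m)},r)=\{X\in\mathcal W^{sm\times sm}:\|X-Y^{(m)}\|_{sm}<r\}$ and $B_{\rm nc}(Y,r)=\coprod_{m\ge1}B(Y^{(m)},r)$. The uniformly-open topology on $\mathcal W_{\rm nc}$ is the one with the nc balls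 $B_{\rm nc}(Y,r)$ as a base. An nc set is a subset of $\mathcal W_{\rm nc}$ closed under direct sums. An nc function $f:\Omega\to\mathcal V_{\rm nc}$ on an nc set is a map with $f(\Omega_n)\subseteq\mathcal V^{n\times n}$ such that $f(X\oplus Y)=f(X)\oplus f(Y)$, and $f(SXS^{-1})=Sf(X)S^{-1}$ whenever $X,SXS^{-1}\in\Omega_n$ and $S\in\mathbb F^{n\times n}$ is invertible. It is Gateaux differentiable if $\delta f(X)(Z)=\lim_{t\to0}t^{-1}(f(X+tZ)-f(X))$ ($t\in\mathbb F$) exists for all $X\in\Omega_n$ and all $Z\in\mathcal W^{n\times n}$, and it is uniformly analytic if it is Gateaux differentiable and every $Y\in\Omega$ is the centre of an nc ball contained in $\Omega$ on which $f$ is bounded. A linear map $A:\mathcal V^{s\times s}\to\mathcal W^{s\times s}$ is completely bounded if the norms of its blockwise amplifications $A^{(k)}:\mathcal V^{sk\times sk}\to\mathcal W^{sk\times sk}$ are bounded uniformly in $k\ge1$. **Theorem (Implicit nc function theorem).** Let $\mathcal X,\mathcal Y,\mathcal Z$ be operator spaces over $\mathbb F$, let $\Omega\subseteq(\mathcal X\times\mathcal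 Y)_{\rm nc}$ be a uniformly open nc set, let $s\in\mathbb N$, $s\ge1$, and $(X^0,Y^0)\in\Omega_s$. Let $F:\Omega\to\mathcal Z_{\rm nc}$ be an nc function such that 1. $F(X^0,Y^0)=0$; 2. $F$ is continuous at $(X^0,Y^0)$ with respect to the uniformly-open topologies on $(\mathcal X\times\mathcal Y)_{\rm nc}$ and $\mathcal Z_{\rm nc}$; 3. the partial derivative $\delta^YF(X^0,Y^0):\mathcal Y^{s\times s}\to\mathcal Z^{s\times s}$, $\delta^YF(X^0,Y^0)(Z)=\lim_{t\to0}t^{-1}\big(F(X^0,Y^0+tZ)-F(X^0,Y^0)\big)$, exists and is a completely bounded linear bijection, and its inverse is completely bounded. Then there are $\alpha,\beta>0$ with the following properties. * (I) $B(X^{0(m)},\alpha)\times B(Y^{0(m)},\beta)\subseteq\Omega_{sm}$ for every $m\ge1$. * (II) There is an nc function $f:B_{\rm nc}(X^0,\alpha)\to B_{\rm nc}(Y^0,\beta)$, uniformly analytic on $B_{\rm nc}(X^0,\alpha)$, such that for all $m\ge1$ and $(X,Y)\in B(X^{0(m)},\alpha)\times B(Y^{0(m)},\beta)$ one has $F(X,Y)=0$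 if and only if $Y=f(X)$. * (III) For every $X\in B_{\rm nc}(X^0,\alpha)$ the partial derivatives $\delta^XF(X,f(X))$ and $\delta^YF(X,f(X))$ exist and are linear, $\delta^YF(X,f(X))$ is a completely bounded bijection with completely bounded inverse, and $$\delta f(X)=-\big(\delta^YF(X,f(X))\big)^{-1}\,\delta^XF(X,f(X)).$$ -/

import Mathlib

open Filter Topology

noncomputable section

namespace NCFun

/-! ## Matrices over a module -/

section Matrices

variable {𝕜 V W : Type*}

/-- `S X` for a scalar matrix `S` and a matrix `X` over a module. -/
def lmul [CommRing 𝕜] [AddCommGroup V] [Module 𝕜 V] {n : ℕ}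
    (S : Matrix (Fin n) (Fin n) 𝕜) (X : Matrix (Fin n) (Fin n) V) :
    Matrix (Fin n) (Fin n) V :=
  Matrix.of fun i j => ∑ k, S i k • X k j

/-- `X T` for a matrix `X` over a module and a scalar matrix `T`. -/
def rmul [CommRing 𝕜] [AddCommGroup V] [Module 𝕜 V] {n : ℕ}
    (X : Matrix (Fin n) (Fin n) V) (T : Matrix (Fin n) (Fin n) 𝕜) :
    Matrix (Fin n) (Fin n) V :=
  Matrix.of fun i j => ∑ k, T k j • X i k

/-- The direct sum `X ⊕ Y`, the block diagonal matrix with diagonal blocks `X` and `Y`. -/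
def dsum [Zero V] {n m : ℕ} (X : Matrix (Fin n) (Fin n) V) (Y : Matrix (Fin m) (Fin m) V) :
    Matrix (Fin (n + m)) (Fin (n + m)) V :=
  Matrix.reindex finSumFinEquiv finSumFinEquiv (Matrix.fromBlocks X 0 0 Y)

/-- `Y^(m) = Y ⊕ ⋯ ⊕ Y` (`m` summands), that is `I_m ⊗ Y`. -/
def amp [Zero V] (m : ℕ) {s : ℕ} (Y : Matrix (Fin s) (Fin s) V) :
    Matrix (Fin (m * s)) (Fin (m * s)) V :=
  Matrix.reindex finProdFinEquiv finProdFinEquiv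
    (Matrix.of fun p q : Fin m × Fin s => if p.1 = q.1 then Y p.2 q.2 else 0)

/-- The `s × s` block in position `(i, j)` of a `k s × k s` matrix. -/
def block {k s : ℕ} (X : Matrix (Fin (k * s)) (Fin (k * s)) V) (i j : Fin k) :
    Matrix (Fin s) (Fin s) V :=
  Matrix.of fun a b => X (finProdFinEquiv (i, a)) (finProdFinEquiv (j, b))

/-- The amplification `A^(k) = id_k ⊗ A` of a map between spaces of `s × s` matrices. It applies
`A` to each block; `k × k` matrices over `V^{s × s}` are identified with `k s × k s` matrices
over `V`. -/
def ampMap (k : ℕ) {s : ℕ} (A : Matrix (Fin s) (Fin s) V → Matrix (Fin s) (Fin s) W)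
    (X : Matrix (Fin (k * s)) (Fin (k * s)) V) : Matrix (Fin (k * s)) (Fin (k * s)) W :=
  Matrix.reindex finProdFinEquiv finProdFinEquiv
    (Matrix.of fun p q : Fin k × Fin s => A (block X p.1 q.1) p.2 q.2)

/-- The matrix over `V × W` with components `X` and `Y`; this is the identification
`(V × W)^{n × n} = V^{n × n} × W^{n × n}`. -/
def pair {n : ℕ} (X : Matrix (Fin n) (Fin n) V) (Y : Matrix (Fin n) (Fin n) W) :
    Matrix (Fin n) (Fin n) (V × W) :=
  Matrix.of fun i j => (X i j, Y i j)

end Matrices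

/-! ## Operator spaces -/

/-- An operator space over `𝕜` (`ℝ` or `ℂ`): Banach space norms `mnorm n` on all `V^{n × n}`
subject to the two conditions of Ruan. (The space `V^{0 × 0}` is zero and imposes nothing.) -/
class OperatorSpace (𝕜 V : Type*) [RCLike 𝕜] [AddCommGroup V] [Module 𝕜 V] where
  mnorm : ∀ n : ℕ, Seminorm 𝕜 (Matrix (Fin n) (Fin n) V)
  eq_zero_of_mnorm : ∀ (n : ℕ) (X : Matrix (Fin n) (Fin n) V), mnorm n X = 0 → X = 0
  complete : ∀ (n : ℕ) (u : ℕ → Matrix (Fin n) (Fin n) V),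
    (∀ ε > 0, ∃ N, ∀ p ≥ N, ∀ q ≥ N, mnorm n (u p - u q) < ε) →
      ∃ X, Tendsto (fun p => mnorm n (u p - X)) atTop (𝓝 0)
  mnorm_dsum : ∀ (n m : ℕ) (X : Matrix (Fin n) (Fin n) V) (Y : Matrix (Fin m) (Fin m) V),
    mnorm (n + m) (dsum X Y) = max (mnorm n X) (mnorm m Y)
  mnorm_mul_le : ∀ (n : ℕ) (S T : Matrix (Fin n) (Fin n) 𝕜) (X : Matrix (Fin n) (Fin n) V),
    mnorm n (rmul (lmul S X) T) ≤
      ‖Matrix.toEuclideanCLM (𝕜 := 𝕜) S‖ * mnorm n X * ‖Matrix.toEuclideanCLM (𝕜 := 𝕜) T‖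

section Prod

variable {𝕜 V W : Type*} [RCLike 𝕜] [AddCommGroup V] [Module 𝕜 V] [AddCommGroup W] [Module 𝕜 W]

/-- Entrywise first component. -/
def fstM (n : ℕ) : Matrix (Fin n) (Fin n) (V × W) →ₗ[𝕜] Matrix (Fin n) (Fin n) V :=
  (LinearMap.fst 𝕜 V W).mapMatrix

/-- Entrywise second component. -/
def sndM (n : ℕ) : Matrix (Fin n) (Fin n) (V × W) →ₗ[𝕜] Matrix (Fin n) (Fin n) W :=
  (LinearMap.snd 𝕜 V W).mapMatrix

theorem mapMatrix_dsum (L : V →ₗ[𝕜] W) {n m : ℕ} (X : Matrix (Fin n) (Fin n) V)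
    (Y : Matrix (Fin m) (Fin m) V) :
    L.mapMatrix (dsum X Y) = dsum (L.mapMatrix X) (L.mapMatrix Y) := by
  ext i j
  refine Fin.addCases (fun i => ?_) (fun i => ?_) i <;>
    refine Fin.addCases (fun j => ?_) (fun j => ?_) j <;> simp [dsum]

theorem mapMatrix_mul (L : V →ₗ[𝕜] W) {n : ℕ} (S T : Matrix (Fin n) (Fin n) 𝕜)
    (X : Matrix (Fin n) (Fin n) V) :
    L.mapMatrix (rmul (lmul S X) T) = rmul (lmul S (L.mapMatrix X)) T := by
  ext i j
  simp [rmul, lmul]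

variable [OperatorSpace 𝕜 V] [OperatorSpace 𝕜 W]

/-- The product operator space, with `‖(X, Y)‖_n = max ‖X‖_n ‖Y‖_n`. -/
instance instOperatorSpaceProd : OperatorSpace 𝕜 (V × W) where
  mnorm n := (OperatorSpace.mnorm n).comp (fstM (𝕜 := 𝕜) (V := V) (W := W) n) ⊔
    (OperatorSpace.mnorm n).comp (sndM (𝕜 := 𝕜) (V := V) (W := W) n)
  eq_zero_of_mnorm := by
    intro n X h
    simp only [Seminorm.sup_apply, Seminorm.comp_apply] at h
    have h1 : OperatorSpace.mnorm n (fstM (𝕜 := 𝕜) n X) = 0 :=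
      le_antisymm (h ▸ le_max_left _ _) (apply_nonneg _ _)
    have h2 : OperatorSpace.mnorm n (sndM (𝕜 := 𝕜) n X) = 0 :=
      le_antisymm (h ▸ le_max_right _ _) (apply_nonneg _ _)
    have h1' := OperatorSpace.eq_zero_of_mnorm n _ h1
    have h2' := OperatorSpace.eq_zero_of_mnorm n _ h2
    ext i j
    · exact congrFun (congrFun h1' i) j
    · exact congrFun (congrFun h2' i) j
  complete := by
    intro n u hu
    simp only [Seminorm.sup_apply, Seminorm.comp_apply, map_sub] at hu ⊢
    obtain ⟨X, hX⟩ := OperatorSpace.complete (𝕜 := 𝕜) n (fun p => fstM (𝕜 := 𝕜) n (u p))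
      fun ε hε => (hu ε hε).imp fun N hN p hp q hq => (le_max_left _ _).trans_lt (hN p hp q hq)
    obtain ⟨Y, hY⟩ := OperatorSpace.complete (𝕜 := 𝕜) n (fun p => sndM (𝕜 := 𝕜) n (u p))
      fun ε hε => (hu ε hε).imp fun N hN p hp q hq => (le_max_right _ _).trans_lt (hN p hp q hq)
    refine ⟨pair X Y, ?_⟩
    have h := hX.max hY
    rw [max_self] at h
    exact h
  mnorm_dsum := by
    intro n m X Y
    simp only [Seminorm.sup_apply, Seminorm.comp_apply, fstM, sndM, mapMatrix_dsum,
      OperatorSpace.mnorm_dsum]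
    exact max_max_max_comm _ _ _ _
  mnorm_mul_le := by
    intro n S T X
    simp only [Seminorm.sup_apply, Seminorm.comp_apply, fstM, sndM, mapMatrix_mul]
    refine max_le ((OperatorSpace.mnorm_mul_le n S T _).trans ?_)
      ((OperatorSpace.mnorm_mul_le n S T _).trans ?_)
    · gcongr
      exact le_max_left _ _
    · gcongr
      exact le_max_right _ _

end Prod

section CompletelyBounded

variable (𝕜 : Type*) {V W : Type*} [RCLike 𝕜] [AddCommGroup V] [Module 𝕜 V] [AddCommGroup W]
  [Module 𝕜 W] [OperatorSpace 𝕜 V] [OperatorSpace 𝕜 W]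

/-- `A : V^{s × s} → W^{s × s}` is completely bounded: the norms of its amplifications `A^(k)`,
`k = 1, 2, …`, are bounded by one constant. -/
def IsCompletelyBounded {s : ℕ} (A : Matrix (Fin s) (Fin s) V →ₗ[𝕜] Matrix (Fin s) (Fin s) W) :
    Prop :=
  ∃ C : ℝ, ∀ k : ℕ, 0 < k → ∀ X : Matrix (Fin (k * s)) (Fin (k * s)) V,
    OperatorSpace.mnorm (𝕜 := 𝕜) (k * s) (ampMap k A X) ≤
      C * OperatorSpace.mnorm (𝕜 := 𝕜) (k * s) X

end CompletelyBounded

/-! ## The nc space, nc sets and nc functions -/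

/-- The nc space over the `𝕜`-module `V`: the disjoint union of the `V^{n × n}`, `n ≥ 1`. -/
structure NCSpace (𝕜 V : Type*) where
  size : ℕ
  pos : 0 < size
  mat : Matrix (Fin size) (Fin size) V

/-- The part `Ω_n = Ω ∩ V^{n × n}` of a subset of the nc space (empty for `n = 0`). -/
def level {𝕜 V : Type*} (Ω : Set (NCSpace 𝕜 V)) (n : ℕ) : Set (Matrix (Fin n) (Fin n) V) :=
  {X | ∃ hn : 0 < n, (⟨n, hn, X⟩ : NCSpace 𝕜 V) ∈ Ω}

/-- A size-preserving map between nc spaces. A function on a subset `Ω` of the nc space is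
represented by such a map, whose values outside `Ω` play no role. -/
abbrev NCMap (V W : Type*) : Type _ :=
  ∀ n : ℕ, Matrix (Fin n) (Fin n) V → Matrix (Fin n) (Fin n) W

/-- A size-preserving map as a map of the disjoint unions. -/
def NCMap.total (𝕜 : Type*) {V W : Type*} (f : NCMap V W) (p : NCSpace 𝕜 V) : NCSpace 𝕜 W :=
  ⟨p.size, p.pos, f p.size p.mat⟩

/-- An nc set is a subset of the nc space that is closed under direct sums. -/
def IsNCSet {𝕜 V : Type*} [Zero V] (Ω : Set (NCSpace 𝕜 V)) : Prop :=
  ∀ (n m : ℕ), ∀ X ∈ level Ω n, ∀ Y ∈ level Ω m, dsum X Y ∈ level Ω (n + m)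

/-- `f` is an nc function on `Ω`: it respects direct sums and similarities. -/
structure IsNCFunction {𝕜 V W : Type*} [CommRing 𝕜] [AddCommGroup V] [Module 𝕜 V]
    [AddCommGroup W] [Module 𝕜 W] (Ω : Set (NCSpace 𝕜 V)) (f : NCMap V W) : Prop where
  map_dsum : ∀ (n m : ℕ), ∀ X ∈ level Ω n, ∀ Y ∈ level Ω m,
    f (n + m) (dsum X Y) = dsum (f n X) (f m Y)
  map_similar : ∀ (n : ℕ), ∀ X ∈ level Ω n, ∀ S : (Matrix (Fin n) (Fin n) 𝕜)ˣ,
    rmul (lmul S.val X) S⁻¹.val ∈ level Ω n →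
      f n (rmul (lmul S.val X) S⁻¹.val) = rmul (lmul S.val (f n X)) S⁻¹.val

/-! ## Balls, the uniformly-open topology, uniform analyticity -/

section Analysis

variable (𝕜 : Type*) {V W : Type*} [RCLike 𝕜] [AddCommGroup V] [Module 𝕜 V] [AddCommGroup W]
  [Module 𝕜 W] [OperatorSpace 𝕜 V] [OperatorSpace 𝕜 W]

/-- The ball `B(Y^(m), r)` in `V^{m s × m s}`. -/
def ampBall {s : ℕ} (Y : Matrix (Fin s) (Fin s) V) (r : ℝ) (m : ℕ) :
    Set (Matrix (Fin (m * s)) (Fin (m * s)) V) :=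
  {X | OperatorSpace.mnorm (𝕜 := 𝕜) (m * s) (X - amp m Y) < r}

/-- The nc ball `B_nc(Y, r)`, the disjoint union of the balls `B(Y^(m), r)`, `m ≥ 1`. -/
def ncBall {s : ℕ} (Y : Matrix (Fin s) (Fin s) V) (r : ℝ) : Set (NCSpace 𝕜 V) :=
  {p | ∃ (m : ℕ) (hm : 0 < m * s), ∃ X ∈ ampBall 𝕜 Y r m, p = ⟨m * s, hm, X⟩}

/-- The uniformly-open topology on the nc space of an operator space, with the nc balls as a
base. -/
instance uniformlyOpenTopology : TopologicalSpace (NCSpace 𝕜 V) :=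
  TopologicalSpace.generateFrom
    {B | ∃ (s : ℕ) (Y : Matrix (Fin s) (Fin s) V) (r : ℝ), 0 < s ∧ 0 < r ∧ B = ncBall 𝕜 Y r}

/-- `D` is the derivative at `X` in the direction `Z` of a map `g : V^{n × n} → W^{n × n}`:
`D = lim_{t → 0} (g(X + t Z) - g(X)) / t`, with `t` in the base field. -/
def HasDirDeriv {n : ℕ} (g : Matrix (Fin n) (Fin n) V → Matrix (Fin n) (Fin n) W)
    (X Z : Matrix (Fin n) (Fin n) V) (D : Matrix (Fin n) (Fin n) W) : Prop :=
  Tendsto (fun t : 𝕜 =>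
    OperatorSpace.mnorm (𝕜 := 𝕜) n (t⁻¹ • (g (X + t • Z) - g X) - D)) (𝓝[≠] 0) (𝓝 0)

variable {𝕜}

/-- The linear map `A` is the Gateaux derivative `δg(X)` of `g : V^{n × n} → W^{n × n}`. -/
def IsGDeriv {n : ℕ} (g : Matrix (Fin n) (Fin n) V → Matrix (Fin n) (Fin n) W)
    (X : Matrix (Fin n) (Fin n) V)
    (A : Matrix (Fin n) (Fin n) V →ₗ[𝕜] Matrix (Fin n) (Fin n) W) : Prop :=
  ∀ Z, HasDirDeriv 𝕜 g X Z (A Z)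

/-- `f` is uniformly locally bounded on `Ω`: around each point of `Ω` there is an nc ball inside
`Ω` on which `f` is bounded. -/
def UniformlyLocallyBounded (Ω : Set (NCSpace 𝕜 V)) (f : NCMap V W) : Prop :=
  ∀ (s : ℕ), ∀ Y ∈ level Ω s, ∃ r > 0, ncBall 𝕜 Y r ⊆ Ω ∧
    ∃ M : ℝ, ∀ (m : ℕ), 0 < m → ∀ X ∈ ampBall 𝕜 Y r m,
      OperatorSpace.mnorm (𝕜 := 𝕜) (m * s) (f (m * s) X) < M

/-- `f` is Gateaux differentiable on `Ω`. -/
def GDifferentiable (Ω : Set (NCSpace 𝕜 V)) (f : NCMap V W) : Prop :=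
  ∀ (n : ℕ), ∀ X ∈ level Ω n, ∀ Z, ∃ D, HasDirDeriv 𝕜 (f n) X Z D

/-- `f` is a uniformly analytic nc function on `Ω`. -/
structure UniformlyAnalytic (Ω : Set (NCSpace 𝕜 V)) (f : NCMap V W) : Prop where
  nc : IsNCFunction Ω f
  bounded : UniformlyLocallyBounded Ω f
  gdiff : GDifferentiable Ω f

end Analysis

end NCFun

end

/-!
Why the theorem holds: everything rests on one algebraic fact and one norm estimate, neither of
which sees the size of the matrices.

*Algebra.* An nc function respects rectangular intertwinings: `X S = S Y` implies
`F(X) S = S F(Y)` (`IsNCFunction.intertwines`), because `X ⊕ Y` then commutes with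
`[[1, S], [0, 1]]`. Consequently `F` maps `[[X, Z], [0, X']]` to a block triangular matrix, and for
`Z = c (X - X')` the off-diagonal block is `c (F(X) - F(X'))` (`IsLocalNC.diffDiff_smul_sub`).

*Estimates.* Continuity at the zero `(X₀, Y₀)` bounds `F` on an nc ball around it. Choosing `c` as
large as the ball permits turns this bound into a Lipschitz bound (`IsLocalNC.lipschitz`); the
Lipschitz bound applied to triangular matrices yields strict differentiability
(`IsLocalNC.strict_deriv`) and Lipschitz dependence of the derivative on the point
(`IsLocalNC.ncDeriv_close`), all with constants independent of the size. The derivative at an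
amplified point is the amplified derivative (`IsLocalNC.ncDeriv_gamp`), so at `(X₀, Y₀)^(m)` the
partial derivative in the second variable is `L^(m)`, whose inverse is bounded uniformly in `m`
(`exists_inverse_of_isAmp`).

*Contraction.* Hence `y ↦ y - Λ F(x, y)`, where `Λ` is the amplification of `L⁻¹`, is a contraction
on balls whose radii do not depend on `m`. Its fixed points define `f`, its contraction constant
gives uniqueness, and perturbing `L^(m)` gives invertibility of the partial derivatives along the
graph together with bounds for all amplifications, that is, complete boundedness. The formula for
`δf` follows by expanding `F(X + tZ, f(X + tZ)) = 0` to first order.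

*`f` is an nc function.* Direct sums are clear from uniqueness. A similarity may move `f(X)` out of
the ball, so uniqueness is applied instead to `[[f(X), c (q f(X') - f(X) q)], [0, f(X')]]` with `c`
small, which is a zero over `X ⊕ X'` whenever `X q = q X'`
(`IsImplicitData.implicitFun_intertwines`).

To keep sizes such as `k * (m * s)` and `(k * m) * s` from interfering, norms and nc functions are
first extended to matrices indexed by arbitrary finite types (`gnorm`, `idxMap`).
-/

noncomputable section

namespace NCFun

/-! ### Norms of matrices indexed by finite types -/

section Norms

variable {𝕜 V : Type*} [RCLike 𝕜] [AddCommGroup V] [Module 𝕜 V]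

/-- Truncated permutation matrices are contractions. -/
theorem norm_truncPerm_le {n : ℕ} (p : Fin n → Prop) [DecidablePred p] (σ : Equiv.Perm (Fin n)) :
    ‖Matrix.toEuclideanCLM (𝕜 := 𝕜)
      (Matrix.of fun i j => if p i ∧ σ i = j then (1 : 𝕜) else 0)‖ ≤ 1 := by
  refine ContinuousLinearMap.opNorm_le_bound _ zero_le_one fun v => ?_
  rw [one_mul]
  have hv : ∀ i, (Matrix.toEuclideanCLM (𝕜 := 𝕜)
      (Matrix.of fun i j => if p i ∧ σ i = j then (1 : 𝕜) else 0) v) i =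
      if p i then v (σ i) else 0 := by
    intro i
    rw [Matrix.ofLp_toEuclideanCLM]
    by_cases h : p i <;> simp [Matrix.mulVec, dotProduct, h]
  rw [EuclideanSpace.norm_eq, EuclideanSpace.norm_eq]
  refine Real.sqrt_le_sqrt ?_
  rw [← Equiv.sum_comp σ (fun i => ‖v i‖ ^ 2)]
  refine Finset.sum_le_sum fun i _ => ?_
  rw [hv]
  split_ifs
  · exact le_rfl
  · simp

variable [OperatorSpace 𝕜 V]

/-- Erasing rows and columns, after permuting both, is multiplication by contractions. -/
theorem mnorm_mask_le {n : ℕ} (p q : Fin n → Prop) [DecidablePred p] [DecidablePred q]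
    (σ τ : Equiv.Perm (Fin n)) (X : Matrix (Fin n) (Fin n) V) :
    OperatorSpace.mnorm (𝕜 := 𝕜) n
      (Matrix.of fun i j => if p i ∧ q j then X (σ i) (τ j) else 0) ≤
      OperatorSpace.mnorm (𝕜 := 𝕜) n X := by
  set S : Matrix (Fin n) (Fin n) 𝕜 := Matrix.of fun i j => if p i ∧ σ i = j then (1 : 𝕜) else 0
    with hS
  set T : Matrix (Fin n) (Fin n) 𝕜 :=
    Matrix.of fun i j => if q (τ.symm i) ∧ τ.symm i = j then (1 : 𝕜) else 0 with hT
  have h : (Matrix.of fun i j => if p i ∧ q j then X (σ i) (τ j) else 0) = rmul (lmul S X) T := by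
    ext i j
    simp only [rmul, lmul, hS, hT, Matrix.of_apply, ite_and, ite_smul, one_smul, zero_smul]
    rw [Finset.sum_eq_single (τ j)]
    · by_cases h1 : p i <;> by_cases h2 : q j <;> simp [h1, h2]
    · intro k _ hk
      have : τ.symm k ≠ j := fun h => hk (by rw [← h, Equiv.apply_symm_apply])
      simp [this]
    · simp
  rw [h]
  refine (OperatorSpace.mnorm_mul_le n S T X).trans ?_
  have h1 := norm_truncPerm_le (𝕜 := 𝕜) p σ
  have h2 := norm_truncPerm_le (𝕜 := 𝕜) (fun i => q (τ.symm i)) τ.symm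
  calc _ ≤ 1 * OperatorSpace.mnorm (𝕜 := 𝕜) n X * 1 := by gcongr
    _ = _ := by ring

variable (𝕜)

/-- The norm on matrices indexed by an arbitrary finite type, obtained by numbering the index
type; by `gnorm_eq` the numbering is immaterial. -/
def gnorm {ι : Type} [Fintype ι] : Seminorm 𝕜 (Matrix ι ι V) :=
  (OperatorSpace.mnorm (Fintype.card ι)).comp
    (Matrix.reindexLinearEquiv 𝕜 V (Fintype.equivFin ι) (Fintype.equivFin ι)).toLinearMap

variable {ι κ : Type} [Fintype ι] [Fintype κ]

theorem gnorm_eq {n : ℕ} (e : Fin n ≃ ι) (X : Matrix ι ι V) :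
    gnorm 𝕜 X = OperatorSpace.mnorm (𝕜 := 𝕜) n (X.submatrix e e) := by
  have hn : n = Fintype.card ι := by simpa using Fintype.card_congr e
  subst hn
  set g := Fintype.equivFin ι
  have key : ∀ (a b : Fin (Fintype.card ι) ≃ ι),
      OperatorSpace.mnorm (𝕜 := 𝕜) _ (X.submatrix a a) ≤
        OperatorSpace.mnorm (𝕜 := 𝕜) _ (X.submatrix b b) := by
    intro a b
    have := mnorm_mask_le (𝕜 := 𝕜) (fun _ => True) (fun _ => True) (a.trans b.symm)
      (a.trans b.symm) (X.submatrix b b)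
    simpa [Matrix.submatrix, Equiv.trans_apply] using this
  exact le_antisymm (key g.symm e) (key e g.symm)

theorem gnorm_fin {n : ℕ} (X : Matrix (Fin n) (Fin n) V) :
    gnorm 𝕜 X = OperatorSpace.mnorm (𝕜 := 𝕜) n X :=
  gnorm_eq 𝕜 (Equiv.refl _) X

theorem gnorm_reindex (e : ι ≃ κ) (X : Matrix κ κ V) :
    gnorm 𝕜 (X.submatrix e e) = gnorm 𝕜 X := by
  rw [gnorm_eq 𝕜 (Fintype.equivFin ι).symm, gnorm_eq 𝕜 ((Fintype.equivFin ι).symm.trans e)]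
  rfl

theorem eq_zero_of_gnorm {X : Matrix ι ι V} (h : gnorm 𝕜 X = 0) : X = 0 := by
  have h1 := OperatorSpace.eq_zero_of_mnorm _ _ h
  ext i j
  simpa using congrFun (congrFun h1 (Fintype.equivFin ι i)) (Fintype.equivFin ι j)

theorem gnorm_mask_le (p q : ι → Prop) [DecidablePred p] [DecidablePred q] (σ τ : ι ≃ ι)
    (X : Matrix ι ι V) :
    gnorm 𝕜 (Matrix.of fun i j => if p i ∧ q j then X (σ i) (τ j) else 0) ≤ gnorm 𝕜 X := by
  set e := (Fintype.equivFin ι).symm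
  rw [gnorm_eq 𝕜 e, gnorm_eq 𝕜 e]
  have := mnorm_mask_le (𝕜 := 𝕜) (fun i => p (e i)) (fun i => q (e i)) ((e.trans σ).trans e.symm)
    ((e.trans τ).trans e.symm) (X.submatrix e e)
  refine le_trans (le_of_eq ?_) this
  congr 1
  ext i j
  simp

theorem gnorm_fromBlocks_diag (X : Matrix ι ι V) (Y : Matrix κ κ V) :
    gnorm 𝕜 (Matrix.fromBlocks X 0 0 Y) = max (gnorm 𝕜 X) (gnorm 𝕜 Y) := by
  set e := (Fintype.equivFin ι).symm
  set g := (Fintype.equivFin κ).symm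
  rw [gnorm_eq 𝕜 e, gnorm_eq 𝕜 g, ← OperatorSpace.mnorm_dsum,
    gnorm_eq 𝕜 (finSumFinEquiv.symm.trans (Equiv.sumCongr e g))]
  congr 1
  ext i j
  refine Fin.addCases (fun i => ?_) (fun i => ?_) i <;>
    refine Fin.addCases (fun j => ?_) (fun j => ?_) j <;> simp [dsum]

/-- The off-diagonal position is reached from the diagonal one by permuting columns. -/
theorem gnorm_fromBlocks_12_le (Z : Matrix ι ι V) :
    gnorm 𝕜 (Matrix.fromBlocks 0 Z 0 0 : Matrix (ι ⊕ ι) (ι ⊕ ι) V) ≤ gnorm 𝕜 Z := by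
  have h := gnorm_mask_le 𝕜 (fun _ => True) (fun _ => True) (Equiv.refl _) (Equiv.sumComm ι ι)
    (Matrix.fromBlocks Z 0 0 0 : Matrix (ι ⊕ ι) (ι ⊕ ι) V)
  rw [gnorm_fromBlocks_diag, map_zero, max_eq_left (apply_nonneg _ _)] at h
  refine le_trans (le_of_eq ?_) h
  congr 1
  ext (i | i) (j | j) <;> simp

theorem gnorm_toBlocks₁₂_le (A : Matrix (ι ⊕ ι) (ι ⊕ ι) V) :
    gnorm 𝕜 A.toBlocks₁₂ ≤ gnorm 𝕜 A := by
  have h := gnorm_mask_le 𝕜 (fun i : ι ⊕ ι => i.isLeft = true) (fun i => i.isLeft = true)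
    (Equiv.refl _) (Equiv.sumComm ι ι) A
  have h2 := gnorm_fromBlocks_diag 𝕜 A.toBlocks₁₂ (0 : Matrix ι ι V)
  rw [map_zero, max_eq_left (apply_nonneg _ _)] at h2
  rw [← h2]
  refine le_trans (le_of_eq ?_) h
  congr 1
  ext (i | i) (j | j) <;> simp [Matrix.toBlocks₁₂]

theorem gnorm_fromBlocks_tri_le (X Z Y : Matrix ι ι V) :
    gnorm 𝕜 (Matrix.fromBlocks X Z 0 Y) ≤ max (gnorm 𝕜 X) (gnorm 𝕜 Y) + gnorm 𝕜 Z := by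
  have h : Matrix.fromBlocks X Z 0 Y =
      Matrix.fromBlocks X 0 0 Y + Matrix.fromBlocks 0 Z 0 0 := by
    simp [Matrix.fromBlocks_add]
  rw [h, ← gnorm_fromBlocks_diag]
  exact (map_add_le_add _ _ _).trans (add_le_add_right (gnorm_fromBlocks_12_le 𝕜 Z) _)

theorem gnorm_fromBlocks_row_le (Z Z' : Matrix ι ι V) :
    gnorm 𝕜 (Matrix.fromBlocks Z Z' 0 0) ≤ gnorm 𝕜 Z + gnorm 𝕜 Z' := by
  refine (gnorm_fromBlocks_tri_le 𝕜 Z Z' 0).trans ?_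
  rw [map_zero, max_eq_left (apply_nonneg _ _)]

/-- The block diagonal matrix with a copy of `X` for each element of `κ`. -/
def gamp (κ : Type) {ι : Type} {V : Type*} [Zero V] (X : Matrix ι ι V) :
    Matrix (κ × ι) (κ × ι) V :=
  open Classical in Matrix.of fun p q => if p.1 = q.1 then X p.2 q.2 else 0

theorem gamp_sub {κ ι : Type} {V : Type*} [AddCommGroup V] (X Y : Matrix ι ι V) :
    gamp κ (X - Y) = gamp κ X - gamp κ Y := by
  ext p q
  by_cases h : p.1 = q.1 <;> simp [gamp, h]

/-- By induction on the number of blocks, since direct sums carry the maximum norm. -/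
theorem gnorm_gamp_le (X : Matrix ι ι V) : gnorm 𝕜 (gamp κ X) ≤ gnorm 𝕜 X := by
  classical
  have key : ∀ k : ℕ, gnorm 𝕜 (gamp (Fin k) X) ≤ gnorm 𝕜 X := by
    intro k
    induction k with
    | zero =>
      have : gamp (Fin 0) X = 0 := by
        ext i j
        exact i.1.elim0
      rw [this, map_zero]
      exact apply_nonneg _ _
    | succ k ih =>
      let e : (Fin k × ι) ⊕ ι ≃ Fin (k + 1) × ι :=
        (Equiv.sumCongr (Equiv.refl _) (Equiv.uniqueProd ι (Fin 1)).symm).trans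
          ((Equiv.sumProdDistrib (Fin k) (Fin 1) ι).symm.trans
            (Equiv.prodCongr finSumFinEquiv (Equiv.refl ι)))
      have h : (gamp (Fin (k + 1)) X).submatrix e e = Matrix.fromBlocks (gamp (Fin k) X) 0 0 X := by
        ext (i | i) (j | j)
        · simp [e, gamp]
        · simp [e, gamp, Fin.ext_iff, i.1.2.ne]
        · simp [e, gamp, Fin.ext_iff, j.1.2.ne']
        · simp [e, gamp]
      rw [← gnorm_reindex 𝕜 e, h, gnorm_fromBlocks_diag]
      exact max_le ih le_rfl
  have h : gamp κ X = (gamp (Fin (Fintype.card κ)) X).submatrix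
      (Equiv.prodCongr (Fintype.equivFin κ) (Equiv.refl ι))
      (Equiv.prodCongr (Fintype.equivFin κ) (Equiv.refl ι)) := by
    ext i j
    simp [gamp]
  rw [h, gnorm_reindex]
  exact key _

end Norms

/-! ### Intertwinings -/

section Intertwining

variable {𝕜 V W : Type*}

/-- `X S = S Y` for a rectangular scalar matrix `S` and square matrices `X`, `Y` over a module. -/
def Intertwines [CommRing 𝕜] [AddCommGroup V] [Module 𝕜 V] {ι κ : Type} [Fintype ι] [Fintype κ]
    (X : Matrix ι ι V) (S : Matrix ι κ 𝕜) (Y : Matrix κ κ V) : Prop :=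
  ∀ i j, ∑ k, S k j • X i k = ∑ k, S i k • Y k j

variable [CommRing 𝕜] [AddCommGroup V] [Module 𝕜 V] [AddCommGroup W] [Module 𝕜 W]

theorem rmul_rmul {n : ℕ} (X : Matrix (Fin n) (Fin n) V) (S T : Matrix (Fin n) (Fin n) 𝕜) :
    rmul (rmul X S) T = rmul X (S * T) := by
  ext i j
  simp only [rmul, Matrix.of_apply, Matrix.mul_apply, Finset.smul_sum, Finset.sum_smul, smul_smul]
  rw [Finset.sum_comm]
  simp only [mul_comm]

theorem rmul_one {n : ℕ} (X : Matrix (Fin n) (Fin n) V) :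
    rmul X (1 : Matrix (Fin n) (Fin n) 𝕜) = X := by
  ext i j
  simp [rmul, Matrix.one_apply]

theorem rmul_inv_eq_iff {n : ℕ} (S : (Matrix (Fin n) (Fin n) 𝕜)ˣ)
    (X Y : Matrix (Fin n) (Fin n) V) : rmul X S⁻¹.val = Y ↔ X = rmul Y S.val := by
  constructor
  · rintro rfl
    rw [rmul_rmul, Units.inv_mul, rmul_one]
  · rintro rfl
    rw [rmul_rmul, Units.mul_inv, rmul_one]

theorem intertwines_iff {n : ℕ} (X Y : Matrix (Fin n) (Fin n) V) (S : Matrix (Fin n) (Fin n) 𝕜) :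
    Intertwines X S Y ↔ rmul X S = lmul S Y := by
  constructor
  · intro h
    ext i j
    exact h i j
  · intro h i j
    exact congrFun (congrFun h i) j

/-- The unipotent matrix `[[1, S], [0, 1]]`. -/
def unipotent {n m : ℕ} (S : Matrix (Fin n) (Fin m) 𝕜) :
    (Matrix (Fin (n + m)) (Fin (n + m)) 𝕜)ˣ where
  val := Matrix.reindex finSumFinEquiv finSumFinEquiv (Matrix.fromBlocks 1 S 0 1)
  inv := Matrix.reindex finSumFinEquiv finSumFinEquiv (Matrix.fromBlocks 1 (-S) 0 1)
  val_inv := by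
    simp [Matrix.submatrix_mul_equiv, Matrix.fromBlocks_multiply, Matrix.fromBlocks_one]
  inv_val := by
    simp [Matrix.submatrix_mul_equiv, Matrix.fromBlocks_multiply, Matrix.fromBlocks_one]

/-- `X ⊕ Y` commutes with `[[1, S], [0, 1]]` exactly when `X S = S Y`. -/
theorem unipotent_comm_iff {n m : ℕ} (X : Matrix (Fin n) (Fin n) V) (Y : Matrix (Fin m) (Fin m) V)
    (S : Matrix (Fin n) (Fin m) 𝕜) :
    lmul (unipotent S).val (dsum X Y) = rmul (dsum X Y) (unipotent S).val ↔
      Intertwines X S Y := by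
  constructor
  · intro h i j
    have := congrFun (congrFun h (Fin.castAdd m i)) (Fin.natAdd n j)
    simpa [lmul, rmul, dsum, unipotent, Fin.sum_univ_add, Matrix.one_apply] using this.symm
  · intro h
    ext i j
    refine Fin.addCases (fun i => ?_) (fun i => ?_) i <;>
      refine Fin.addCases (fun j => ?_) (fun j => ?_) j
    · simp [lmul, rmul, dsum, unipotent, Fin.sum_univ_add, Matrix.one_apply]
    · simpa [lmul, rmul, dsum, unipotent, Fin.sum_univ_add, Matrix.one_apply] using (h i j).symm
    · simp [lmul, rmul, dsum, unipotent, Fin.sum_univ_add, Matrix.one_apply]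
    · simp [lmul, rmul, dsum, unipotent, Fin.sum_univ_add, Matrix.one_apply]

/-- nc functions respect intertwinings: `X S = S Y` implies `F(X) S = S F(Y)`. -/
theorem IsNCFunction.intertwines {Ω : Set (NCSpace 𝕜 V)} {F : NCMap V W} (hF : IsNCFunction Ω F)
    (hΩ : IsNCSet Ω) {n m : ℕ} {X : Matrix (Fin n) (Fin n) V} {Y : Matrix (Fin m) (Fin m) V}
    (hX : X ∈ level Ω n) (hY : Y ∈ level Ω m) {S : Matrix (Fin n) (Fin m) 𝕜}
    (h : Intertwines X S Y) : Intertwines (F n X) S (F m Y) := by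
  have h1 := (rmul_inv_eq_iff (unipotent S) _ _).2 ((unipotent_comm_iff X Y S).2 h)
  have hd := hΩ n m X hX Y hY
  have h2 := hF.map_similar (n + m) (dsum X Y) hd (unipotent S) (by rw [h1]; exact hd)
  rw [h1, hF.map_dsum n m X hX Y hY] at h2
  exact (unipotent_comm_iff _ _ S).1 ((rmul_inv_eq_iff _ _ _).1 h2.symm)

variable {ι κ ι' κ' : Type} [Fintype ι] [Fintype κ] [Fintype ι'] [Fintype κ']

theorem intertwines_submatrix_iff (e : ι' ≃ ι) (g : κ' ≃ κ) (X : Matrix ι ι V) (S : Matrix ι κ 𝕜)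
    (Y : Matrix κ κ V) :
    Intertwines (X.submatrix e e) (S.submatrix e g) (Y.submatrix g g) ↔ Intertwines X S Y := by
  have h : ∀ i j, (∑ k, (S.submatrix e g) k j • (X.submatrix e e) i k =
      ∑ k, (S.submatrix e g) i k • (Y.submatrix g g) k j) ↔
      ∑ k, S k (g j) • X (e i) k = ∑ k, S (e i) k • Y k (g j) := by
    intro i j
    rw [← Equiv.sum_comp e (fun k => S k (g j) • X (e i) k),
      ← Equiv.sum_comp g (fun k => S (e i) k • Y k (g j))]
    rfl
  constructor
  · intro H i j
    have := (h (e.symm i) (g.symm j)).1 (H _ _)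
    simpa using this
  · intro H i j
    exact (h i j).2 (H _ _)

/-- The matrices indexed by `ι` some numbering of which belongs to `Ω`. -/
def idxLevel {𝕜 V : Type*} (Ω : Set (NCSpace 𝕜 V)) (ι : Type) : Set (Matrix ι ι V) :=
  {X | ∃ (n : ℕ) (e : Fin n ≃ ι), X.submatrix e e ∈ level Ω n}

/-- The extension of a size-preserving map to matrices indexed by an arbitrary type, through some
numbering that lands in `Ω`. For nc functions it does not depend on the numbering, see
`IsNCFunction.idxMap_eq`. -/
def idxMap {𝕜 V W : Type*} [Zero W] (Ω : Set (NCSpace 𝕜 V)) (F : NCMap V W) (ι : Type) (X : Matrix ι ι V) :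
    Matrix ι ι W :=
  open Classical in
  if h : X ∈ idxLevel Ω ι then
    (F h.choose (X.submatrix h.choose_spec.choose h.choose_spec.choose)).submatrix
      h.choose_spec.choose.symm h.choose_spec.choose.symm
  else 0

theorem exists_idxMap_eq {𝕜 V W : Type*} [Zero W] {ι : Type} {Ω : Set (NCSpace 𝕜 V)} (F : NCMap V W) {X : Matrix ι ι V}
    (hX : X ∈ idxLevel Ω ι) : ∃ (n : ℕ) (e : Fin n ≃ ι), X.submatrix e e ∈ level Ω n ∧
      idxMap Ω F ι X = (F n (X.submatrix e e)).submatrix e.symm e.symm := by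
  refine ⟨hX.choose, hX.choose_spec.choose, hX.choose_spec.choose_spec, ?_⟩
  rw [idxMap, dif_pos hX]

theorem IsNCFunction.idxMap_intertwines {Ω : Set (NCSpace 𝕜 V)} {F : NCMap V W}
    (hF : IsNCFunction Ω F) (hΩ : IsNCSet Ω) {X : Matrix ι ι V} {Y : Matrix κ κ V}
    (hX : X ∈ idxLevel Ω ι) (hY : Y ∈ idxLevel Ω κ) {S : Matrix ι κ 𝕜}
    (h : Intertwines X S Y) : Intertwines (idxMap Ω F ι X) S (idxMap Ω F κ Y) := by
  obtain ⟨n, e, he, hXe⟩ := exists_idxMap_eq F hX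
  obtain ⟨m, g, hg, hYg⟩ := exists_idxMap_eq F hY
  have := hF.intertwines hΩ he hg ((intertwines_submatrix_iff e g X S Y).2 h)
  rw [hXe, hYg, ← intertwines_submatrix_iff e g]
  simpa [Matrix.submatrix_submatrix] using this

theorem intertwines_one_iff [DecidableEq ι] (X Y : Matrix ι ι V) :
    Intertwines X (1 : Matrix ι ι 𝕜) Y ↔ X = Y := by
  simp [Intertwines, Matrix.one_apply, ← Matrix.ext_iff]

theorem IsNCFunction.idxMap_eq {Ω : Set (NCSpace 𝕜 V)} {F : NCMap V W}
    (hF : IsNCFunction Ω F) (hΩ : IsNCSet Ω) {X : Matrix ι ι V} {n : ℕ} (e : Fin n ≃ ι)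
    (hX : X.submatrix e e ∈ level Ω n) :
    idxMap Ω F ι X = (F n (X.submatrix e e)).submatrix e.symm e.symm := by
  classical
  have hX' : X ∈ idxLevel Ω ι := ⟨n, e, hX⟩
  obtain ⟨m, g, hg, hXg⟩ := exists_idxMap_eq F hX'
  have := hF.intertwines hΩ hg hX
    ((intertwines_submatrix_iff g e X (1 : Matrix ι ι 𝕜) X).2 ((intertwines_one_iff _ _).2 rfl))
  rw [hXg, ← intertwines_one_iff (𝕜 := 𝕜), ← intertwines_submatrix_iff g e]
  simpa [Matrix.submatrix_submatrix] using this

theorem IsNCFunction.idxMap_fin {Ω : Set (NCSpace 𝕜 V)} {F : NCMap V W}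
    (hF : IsNCFunction Ω F) (hΩ : IsNCSet Ω) {n : ℕ} {X : Matrix (Fin n) (Fin n) V}
    (hX : X ∈ level Ω n) : idxMap Ω F (Fin n) X = F n X :=
  hF.idxMap_eq hΩ (Equiv.refl _) hX

end Intertwining

/-! ### Difference-differential calculus -/

section Calculus

variable {𝕜 V W : Type*} [RCLike 𝕜] [AddCommGroup V] [Module 𝕜 V] [OperatorSpace 𝕜 V]
  [AddCommGroup W] [Module 𝕜 W] [OperatorSpace 𝕜 W]

/-- A family of maps `G ι` on matrices indexed by finite types, given on the balls of radius `δ`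
around a family `Good` of centres that is closed under direct sums, reindexing and amplification;
on these balls it respects intertwinings and is bounded by `M`, uniformly in the size. -/
structure IsLocalNC (𝕜 : Type*) {V W : Type*} [RCLike 𝕜] [AddCommGroup V] [Module 𝕜 V]
    [OperatorSpace 𝕜 V] [AddCommGroup W] [Module 𝕜 W] [OperatorSpace 𝕜 W]
    (Good : ∀ ι : Type, Matrix ι ι V → Prop)
    (G : ∀ ι : Type, Matrix ι ι V → Matrix ι ι W) (δ M : ℝ) : Prop where
  delta_pos : 0 < δ
  bound_pos : 0 < M
  good_sum : ∀ {ι κ : Type} {P : Matrix ι ι V} {Q : Matrix κ κ V}, Good ι P → Good κ Q →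
    Good (ι ⊕ κ) (Matrix.fromBlocks P 0 0 Q)
  good_amp : ∀ {ι : Type} {P : Matrix ι ι V} (κ : Type) [Fintype κ] [Nonempty κ], Good ι P →
    Good (κ × ι) (gamp κ P)
  good_reindex : ∀ {ι κ : Type} {P : Matrix ι ι V} (e : κ ≃ ι), Good ι P →
    Good κ (P.submatrix e e)
  intertwines : ∀ {ι κ : Type} [Fintype ι] [Fintype κ] {P X : Matrix ι ι V} {Q Y : Matrix κ κ V}
    {S : Matrix ι κ 𝕜}, Good ι P → Good κ Q → gnorm 𝕜 (X - P) < δ → gnorm 𝕜 (Y - Q) < δ →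
    Intertwines X S Y → Intertwines (G ι X) S (G κ Y)
  bounded : ∀ {ι : Type} [Fintype ι] {P X : Matrix ι ι V}, Good ι P → gnorm 𝕜 (X - P) < δ →
    gnorm 𝕜 (G ι X) ≤ M

/-- The difference-differential operator: the off-diagonal block of `G` at the upper triangular
matrix `[[X, Z], [0, X']]`. -/
def diffDiff (G : ∀ ι : Type, Matrix ι ι V → Matrix ι ι W) {ι : Type} (X X' Z : Matrix ι ι V) :
    Matrix ι ι W :=
  (G (ι ⊕ ι) (Matrix.fromBlocks X Z 0 X')).toBlocks₁₂

/-- A scalar multiple of prescribed norm. -/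
theorem exists_smul_gnorm_eq {ι : Type} [Fintype ι] {Z : Matrix ι ι V} (hZ : gnorm 𝕜 Z ≠ 0) {r : ℝ}
    (hr : 0 < r) : ∃ c : ℝ, 0 < c ∧ c * gnorm 𝕜 Z = r ∧
      gnorm 𝕜 ((c : 𝕜) • Z) = r := by
  have hpos : 0 < gnorm 𝕜 Z := lt_of_le_of_ne (apply_nonneg _ _) hZ.symm
  refine ⟨r / gnorm 𝕜 Z, by positivity, by field_simp, ?_⟩
  rw [map_smul_eq_mul, RCLike.norm_ofReal, abs_of_pos (by positivity)]
  field_simp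

theorem exists_smul_gnorm_le {ι : Type} [Fintype ι] (Z : Matrix ι ι V) {r : ℝ} (hr : 0 < r) :
    ∃ c₀ : ℝ, 0 < c₀ ∧ ∀ c : ℝ, 0 ≤ c → c ≤ c₀ → gnorm 𝕜 ((c : 𝕜) • Z) ≤ r := by
  have h0 : 0 ≤ gnorm 𝕜 Z := apply_nonneg _ _
  refine ⟨r / (1 + gnorm 𝕜 Z), by positivity, fun c hc hc' => ?_⟩
  rw [map_smul_eq_mul, RCLike.norm_ofReal, abs_of_nonneg hc]
  calc c * gnorm 𝕜 Z ≤ r / (1 + gnorm 𝕜 Z) * (1 + gnorm 𝕜 Z) := by gcongr; linarith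
    _ = r := by field_simp

variable {Good : ∀ ι : Type, Matrix ι ι V → Prop} {G : ∀ ι : Type, Matrix ι ι V → Matrix ι ι W}
  {δ M : ℝ}

variable {ι κ : Type} [Fintype ι] [Fintype κ]

theorem gnorm_tri_sub_lt {P X X' Z : Matrix ι ι V} {r r' : ℝ} (hX : gnorm 𝕜 (X - P) < r)
    (hX' : gnorm 𝕜 (X' - P) < r) (hZ : gnorm 𝕜 Z ≤ r') :
    gnorm 𝕜 (Matrix.fromBlocks X Z 0 X' - Matrix.fromBlocks P 0 0 P) < r + r' := by
  have h : Matrix.fromBlocks X Z 0 X' - Matrix.fromBlocks P 0 0 P =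
      Matrix.fromBlocks (X - P) Z 0 (X' - P) := by
    ext (i | i) (j | j) <;> simp
  rw [h]
  exact (gnorm_fromBlocks_tri_le 𝕜 _ _ _).trans_lt (add_lt_add_of_lt_of_le (max_lt hX hX') hZ)

/-- The difference-differential operator respects intertwinings of its three arguments. -/
theorem IsLocalNC.diffDiff_intertwines (hG : IsLocalNC 𝕜 Good G δ M) {P X X' Z : Matrix ι ι V}
    {Q Y Y' Z' : Matrix κ κ V} (hP : Good ι P) (hQ : Good κ Q) (hX : gnorm 𝕜 (X - P) < δ / 4)
    (hX' : gnorm 𝕜 (X' - P) < δ / 4) (hZ : gnorm 𝕜 Z ≤ δ / 4) (hY : gnorm 𝕜 (Y - Q) < δ / 4)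
    (hY' : gnorm 𝕜 (Y' - Q) < δ / 4) (hZ' : gnorm 𝕜 Z' ≤ δ / 4) {S S' : Matrix ι κ 𝕜}
    (h : Intertwines X S Y) (h' : Intertwines X' S' Y')
    (hZZ : ∀ i j, ∑ k, S' k j • Z i k = ∑ k, S i k • Z' k j) (i : ι) (j : κ) :
    ∑ k, S' k j • diffDiff G X X' Z i k = ∑ k, S i k • diffDiff G Y Y' Z' k j := by
  have hδ := hG.delta_pos
  have := hG.intertwines (S := Matrix.fromBlocks S 0 0 S') (hG.good_sum hP hP)
    (hG.good_sum hQ hQ) ((gnorm_tri_sub_lt hX hX' hZ).trans (by linarith))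
    ((gnorm_tri_sub_lt hY hY' hZ').trans (by linarith)) ?_
  · simpa [diffDiff, Matrix.toBlocks₁₂] using this (Sum.inl i) (Sum.inr j)
  · rintro (i | i) (j | j)
    · simpa using h i j
    · simpa using hZZ i j
    · simp
    · simpa using h' i j

/-- The difference formula: at `Z = c (X - X')` the off-diagonal block is `c (G X - G X')`. -/
theorem IsLocalNC.diffDiff_smul_sub (hG : IsLocalNC 𝕜 Good G δ M) {P X X' : Matrix ι ι V}
    (hP : Good ι P) (hX : gnorm 𝕜 (X - P) < δ) (hX' : gnorm 𝕜 (X' - P) < δ) (c : 𝕜)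
    (hA : gnorm 𝕜 (Matrix.fromBlocks X (c • (X - X')) 0 X' - Matrix.fromBlocks P 0 0 P) < δ) :
    diffDiff G X X' (c • (X - X')) = c • (G ι X - G ι X') := by
  classical
  -- the two intertwinings `A [1; 0] = [1; 0] X` and `A [-c; 1] = [-c; 1] X'`
  have h1 := hG.intertwines (S := Matrix.of fun (i : ι ⊕ ι) j =>
    Sum.elim (fun i => if i = j then (1 : 𝕜) else 0) (fun _ => 0) i)
    (hG.good_sum hP hP) hP hA hX (by rintro (i | i) j <;> simp)
  have h2 := hG.intertwines (S := Matrix.of fun (i : ι ⊕ ι) j =>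
    Sum.elim (fun i => if i = j then -c else 0) (fun i => if i = j then 1 else 0) i)
    (hG.good_sum hP hP) hP hA hX' (by
      rintro (i | i) j
      · simp only [Matrix.of_apply, Fintype.sum_sum_type]
        simp only [smul_sub]
        simp
        abel
      · simp)
  ext i j
  have e1 := h1 (Sum.inl i) j
  have e2 := h2 (Sum.inl i) j
  simp only [Matrix.of_apply, Fintype.sum_sum_type, Sum.elim_inl, Sum.elim_inr, ite_smul, one_smul,
    zero_smul, Finset.sum_ite_eq, Finset.sum_ite_eq', Finset.mem_univ, if_true,
    Finset.sum_const_zero, add_zero] at e1 e2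
  rw [e1] at e2
  simp only [diffDiff, Matrix.toBlocks₁₂, Matrix.of_apply, Matrix.smul_apply, Matrix.sub_apply]
  rw [← sub_eq_zero] at e2 ⊢
  exact Eq.trans (by module) e2

theorem IsLocalNC.gnorm_diffDiff_le (hG : IsLocalNC 𝕜 Good G δ M) {P X X' Z : Matrix ι ι V}
    (hP : Good ι P)
    (hA : gnorm 𝕜 (Matrix.fromBlocks X Z 0 X' - Matrix.fromBlocks P 0 0 P) < δ) :
    gnorm 𝕜 (diffDiff G X X' Z) ≤ M :=
  (gnorm_toBlocks₁₂_le 𝕜 _).trans (hG.bounded (hG.good_sum hP hP) hA)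

/-- Bounded nc functions are Lipschitz on smaller balls, uniformly in the size. -/
theorem IsLocalNC.lipschitz (hG : IsLocalNC 𝕜 Good G δ M) {P X X' : Matrix ι ι V}
    (hP : Good ι P) (hX : gnorm 𝕜 (X - P) < δ / 2) (hX' : gnorm 𝕜 (X' - P) < δ / 2) :
    gnorm 𝕜 (G ι X - G ι X') ≤ 2 * M / δ * gnorm 𝕜 (X - X') := by
  have hδ := hG.delta_pos
  have hM := hG.bound_pos
  by_cases h0 : gnorm 𝕜 (X - X') = 0
  · rw [sub_eq_zero.1 (eq_zero_of_gnorm 𝕜 h0)]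
    simp
  obtain ⟨c, hc, hc1, hc2⟩ := exists_smul_gnorm_eq h0 (half_pos hδ)
  have hA := gnorm_tri_sub_lt hX hX' hc2.le
  rw [add_halves] at hA
  have h := hG.gnorm_diffDiff_le hP hA
  rw [hG.diffDiff_smul_sub hP (hX.trans (by linarith)) (hX'.trans (by linarith)) _ hA,
    map_smul_eq_mul, RCLike.norm_ofReal, abs_of_pos hc] at h
  have : c * gnorm 𝕜 (G ι X - G ι X') ≤ c * (2 * M / δ * gnorm 𝕜 (X - X')) := by
    calc _ ≤ M := h
      _ = 2 * M / δ * (c * gnorm 𝕜 (X - X')) := by rw [hc1]; field_simp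
      _ = _ := by ring
  exact le_of_mul_le_mul_left this hc

/-- The Lipschitz bound for `G` at triangular matrices is a Lipschitz bound for the
difference-differential operator in its two base points. -/
theorem IsLocalNC.diffDiff_close (hG : IsLocalNC 𝕜 Good G δ M) {P X X' R Z : Matrix ι ι V}
    (hP : Good ι P) (hX : gnorm 𝕜 (X - P) < δ / 4) (hX' : gnorm 𝕜 (X' - P) < δ / 4)
    (hR : gnorm 𝕜 (R - P) < δ / 4) (hZ : gnorm 𝕜 Z ≤ δ / 4) :
    gnorm 𝕜 (diffDiff G X X' Z - diffDiff G R R Z) ≤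
      2 * M / δ * max (gnorm 𝕜 (X - R)) (gnorm 𝕜 (X' - R)) := by
  have h1 := gnorm_tri_sub_lt hX hX' hZ
  have h2 := gnorm_tri_sub_lt hR hR hZ
  rw [show δ / 4 + δ / 4 = δ / 2 by ring] at h1 h2
  have h := hG.lipschitz (hG.good_sum hP hP) h1 h2
  have h3 : Matrix.fromBlocks X Z 0 X' - Matrix.fromBlocks R Z 0 R =
      Matrix.fromBlocks (X - R) 0 0 (X' - R) := by
    ext (i | i) (j | j) <;> simp
  rw [h3, gnorm_fromBlocks_diag] at h
  exact (gnorm_toBlocks₁₂_le 𝕜 (G (ι ⊕ ι) (Matrix.fromBlocks X Z 0 X') -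
    G (ι ⊕ ι) (Matrix.fromBlocks R Z 0 R))).trans h

omit [OperatorSpace 𝕜 V] in
theorem intertwines_smul_one [DecidableEq ι] (X : Matrix ι ι V) (c : 𝕜) :
    Intertwines X (c • (1 : Matrix ι ι 𝕜)) X := by
  intro i j
  simp [Matrix.one_apply]

/-- Homogeneity, from the intertwining `diag(c, 1)`. -/
theorem IsLocalNC.diffDiff_smul (hG : IsLocalNC 𝕜 Good G δ M) {P R Z : Matrix ι ι V}
    (hP : Good ι P) (hR : gnorm 𝕜 (R - P) < δ / 4) (c : 𝕜) (hZ : gnorm 𝕜 Z ≤ δ / 4)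
    (hcZ : gnorm 𝕜 (c • Z) ≤ δ / 4) : diffDiff G R R (c • Z) = c • diffDiff G R R Z := by
  classical
  ext i j
  have := hG.diffDiff_intertwines hP hP hR hR hcZ hR hR hZ (intertwines_smul_one R c)
    (intertwines_smul_one R 1) (by intro i j; simp [Matrix.one_apply]) i j
  simpa [Matrix.one_apply] using this

/-- Additivity, read off from the single matrix with off-diagonal block `[[Z, Z'], [0, 0]]`. -/
theorem IsLocalNC.diffDiff_add (hG : IsLocalNC 𝕜 Good G δ M) {P R Z Z' : Matrix ι ι V}
    (hP : Good ι P) (hR : gnorm 𝕜 (R - P) < δ / 4) (hZ : gnorm 𝕜 Z ≤ δ / 8)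
    (hZ' : gnorm 𝕜 Z' ≤ δ / 8) :
    diffDiff G R R (Z + Z') = diffDiff G R R Z + diffDiff G R R Z' := by
  classical
  have hδ := hG.delta_pos
  have hRR : gnorm 𝕜 (Matrix.fromBlocks R 0 0 R - Matrix.fromBlocks P 0 0 P) < δ / 4 := by
    simpa using gnorm_tri_sub_lt hR hR (map_zero (gnorm 𝕜 (V := V) (ι := ι))).le
  have hrow : gnorm 𝕜 (Matrix.fromBlocks Z Z' 0 0) ≤ δ / 4 :=
    (gnorm_fromBlocks_row_le 𝕜 Z Z').trans (by linarith)
  have hadd : gnorm 𝕜 (Z + Z') ≤ δ / 4 := (map_add_le_add _ _ _).trans (by linarith)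
  -- `[[Z, Z'], [0, 0]]` multiplied from the right by `[a; b]` is `[a Z + b Z'; 0]`
  have key : ∀ (a b : 𝕜) (Y : Matrix ι ι V), gnorm 𝕜 Y ≤ δ / 4 → Y = a • Z + b • Z' →
      ∀ i j, a • diffDiff G (Matrix.fromBlocks R 0 0 R) (Matrix.fromBlocks R 0 0 R)
        (Matrix.fromBlocks Z Z' 0 0) (Sum.inl i) (Sum.inl j) +
        b • diffDiff G (Matrix.fromBlocks R 0 0 R) (Matrix.fromBlocks R 0 0 R)
        (Matrix.fromBlocks Z Z' 0 0) (Sum.inl i) (Sum.inr j) = diffDiff G R R Y i j := by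
    rintro a b Y hY rfl i j
    have := hG.diffDiff_intertwines (S := Matrix.of fun (i : ι ⊕ ι) j =>
      Sum.elim (fun i => if i = j then (1 : 𝕜) else 0) (fun _ => 0) i)
      (S' := Matrix.of fun (i : ι ⊕ ι) j =>
      Sum.elim (fun i => if i = j then a else 0) (fun i => if i = j then b else 0) i)
      (hG.good_sum hP hP) hP hRR hRR hrow hR hR hY (by rintro (i | i) j <;> simp)
      (by rintro (i | i) j <;> simp) (by rintro (i | i) j <;> simp [Finset.sum_add_distrib]) (Sum.inl i) j
    simpa using this
  ext i j
  have e1 := key 1 0 Z (by linarith) (by simp) i j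
  have e2 := key 0 1 Z' (by linarith) (by simp) i j
  have e3 := key 1 1 (Z + Z') hadd (by simp) i j
  rw [Matrix.add_apply, ← e1, ← e2, ← e3]
  simp

/-- The difference-differential operator at `(R, R)`, which is homogeneous and additive on small
arguments, extends to a linear map. -/
theorem IsLocalNC.exists_linear (hG : IsLocalNC 𝕜 Good G δ M) {P R : Matrix ι ι V}
    (hP : Good ι P) (hR : gnorm 𝕜 (R - P) < δ / 4) :
    ∃ D : Matrix ι ι V →ₗ[𝕜] Matrix ι ι W,
      ∀ Z, gnorm 𝕜 Z ≤ δ / 4 → D Z = diffDiff G R R Z := by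
  have hδ := hG.delta_pos
  have hex : ∀ Z : Matrix ι ι V, ∃ c : ℝ, 0 < c ∧ gnorm 𝕜 ((c : 𝕜) • Z) ≤ δ / 4 := by
    intro Z
    obtain ⟨c, hc, h⟩ := exists_smul_gnorm_le (𝕜 := 𝕜) Z (r := δ / 4) (by linarith)
    exact ⟨c, hc, h c hc.le le_rfl⟩
  choose c hc hcle using hex
  have hc0 : ∀ Z, (c Z : 𝕜) ≠ 0 := fun Z => RCLike.ofReal_ne_zero.2 (hc Z).ne'
  -- the value `a⁻¹ • diffDiff G R R (a • Z)` does not depend on the scale `a`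
  have key : ∀ (Z : Matrix ι ι V) (a : 𝕜), a ≠ 0 → gnorm 𝕜 (a • Z) ≤ δ / 4 →
      ((c Z : 𝕜))⁻¹ • diffDiff G R R ((c Z : 𝕜) • Z) = a⁻¹ • diffDiff G R R (a • Z) := by
    intro Z a ha haZ
    have h : (c Z : 𝕜) • Z = ((c Z : 𝕜) * a⁻¹) • a • Z := by
      rw [smul_smul, mul_assoc, inv_mul_cancel₀ ha, mul_one]
    have h2 := hG.diffDiff_smul hP hR ((c Z : 𝕜) * a⁻¹) haZ (by rw [← h]; exact hcle Z)
    rw [h, h2, smul_smul, ← mul_assoc, inv_mul_cancel₀ (hc0 Z), one_mul]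
  refine ⟨
    { toFun := fun Z => ((c Z : 𝕜))⁻¹ • diffDiff G R R ((c Z : 𝕜) • Z)
      map_add' := ?_
      map_smul' := ?_ }, ?_⟩
  · intro Z Z'
    obtain ⟨a, ha, ha'⟩ := exists_smul_gnorm_le (𝕜 := 𝕜) Z (r := δ / 8) (by linarith)
    obtain ⟨b, hb, hb'⟩ := exists_smul_gnorm_le (𝕜 := 𝕜) Z' (r := δ / 8) (by linarith)
    have hm : 0 < min a b := lt_min ha hb
    have hm0 : ((min a b : ℝ) : 𝕜) ≠ 0 := RCLike.ofReal_ne_zero.2 hm.ne'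
    have h1 := ha' _ hm.le (min_le_left _ _)
    have h2 := hb' _ hm.le (min_le_right _ _)
    have h3 : gnorm 𝕜 (((min a b : ℝ) : 𝕜) • (Z + Z')) ≤ δ / 4 := by
      rw [smul_add]
      exact (map_add_le_add _ _ _).trans (by linarith)
    rw [key (Z + Z') _ hm0 h3, key Z _ hm0 (by linarith), key Z' _ hm0 (by linarith), smul_add,
      hG.diffDiff_add hP hR h1 h2, smul_add]
  · intro a Z
    by_cases ha : a = 0
    · have h0 : diffDiff G R R 0 = 0 := by
        have := hG.diffDiff_smul (Z := 0) hP hR (0 : 𝕜) (by simp; linarith) (by simp; linarith)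
        simpa using this
      simp [ha, h0]
    · simp only [RingHom.id_apply]
      have h : (c (a • Z) : 𝕜) • a • Z = ((c (a • Z) : 𝕜) * a) • Z := smul_smul _ _ _
      rw [key Z ((c (a • Z) : 𝕜) * a) (mul_ne_zero (hc0 _) ha) (by rw [← h]; exact hcle _), h,
        smul_smul]
      congr 1
      field_simp [hc0 (a • Z)]
  · intro Z hZ
    change ((c Z : 𝕜))⁻¹ • diffDiff G R R ((c Z : 𝕜) • Z) = _
    rw [key Z 1 one_ne_zero (by simpa using hZ)]
    simp

variable (𝕜) in
/-- The derivative of an nc function at `R`, as a linear map: the extension of the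
difference-differential operator at `(R, R)` from small arguments to all arguments (and `0` where
there is no such extension). -/
def ncDeriv (G : ∀ ι : Type, Matrix ι ι V → Matrix ι ι W) (δ : ℝ) (R : Matrix ι ι V) :
    Matrix ι ι V →ₗ[𝕜] Matrix ι ι W :=
  open Classical in
  if h : ∃ D : Matrix ι ι V →ₗ[𝕜] Matrix ι ι W,
      ∀ Z, gnorm 𝕜 Z ≤ δ / 4 → D Z = diffDiff G R R Z then h.choose else 0

theorem IsLocalNC.ncDeriv_eq (hG : IsLocalNC 𝕜 Good G δ M) {P R Z : Matrix ι ι V}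
    (hP : Good ι P) (hR : gnorm 𝕜 (R - P) < δ / 4) (hZ : gnorm 𝕜 Z ≤ δ / 4) :
    ncDeriv 𝕜 G δ R Z = diffDiff G R R Z := by
  have h := hG.exists_linear hP hR
  rw [ncDeriv, dif_pos h]
  exact h.choose_spec Z hZ

theorem IsLocalNC.gnorm_ncDeriv_le (hG : IsLocalNC 𝕜 Good G δ M) {P R : Matrix ι ι V}
    (hP : Good ι P) (hR : gnorm 𝕜 (R - P) < δ / 4) (Z : Matrix ι ι V) :
    gnorm 𝕜 (ncDeriv 𝕜 G δ R Z) ≤ 4 * M / δ * gnorm 𝕜 Z := by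
  have hδ := hG.delta_pos
  by_cases h0 : gnorm 𝕜 Z = 0
  · rw [eq_zero_of_gnorm 𝕜 h0]
    simp
  obtain ⟨c, hc, hc1, hc2⟩ := exists_smul_gnorm_eq (r := δ / 4) h0 (by linarith)
  have h : gnorm 𝕜 (ncDeriv 𝕜 G δ R ((c : 𝕜) • Z)) ≤ M := by
    rw [hG.ncDeriv_eq hP hR hc2.le]
    exact hG.gnorm_diffDiff_le hP ((gnorm_tri_sub_lt hR hR hc2.le).trans (by linarith))
  rw [map_smul, map_smul_eq_mul, RCLike.norm_ofReal, abs_of_pos hc] at h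
  refine le_of_mul_le_mul_left (h.trans (le_of_eq ?_)) hc
  calc M = 4 * M / δ * (c * gnorm 𝕜 Z) := by rw [hc1]; field_simp
    _ = _ := by ring

/-- Strict differentiability with constants that do not depend on the size. -/
theorem IsLocalNC.strict_deriv (hG : IsLocalNC 𝕜 Good G δ M) {P X X' R : Matrix ι ι V}
    (hP : Good ι P) (hX : gnorm 𝕜 (X - P) < δ / 4) (hX' : gnorm 𝕜 (X' - P) < δ / 4)
    (hR : gnorm 𝕜 (R - P) < δ / 4) :
    gnorm 𝕜 (G ι X - G ι X' - ncDeriv 𝕜 G δ R (X - X')) ≤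
      8 * M / δ ^ 2 * max (gnorm 𝕜 (X - R)) (gnorm 𝕜 (X' - R)) * gnorm 𝕜 (X - X') := by
  have hδ := hG.delta_pos
  by_cases h0 : gnorm 𝕜 (X - X') = 0
  · rw [sub_eq_zero.1 (eq_zero_of_gnorm 𝕜 h0)]
    simp
  obtain ⟨c, hc, hc1, hc2⟩ := exists_smul_gnorm_eq (r := δ / 4) h0 (by linarith)
  have h := hG.diffDiff_close hP hX hX' hR hc2.le
  rw [hG.diffDiff_smul_sub hP (hX.trans (by linarith)) (hX'.trans (by linarith)) _
    ((gnorm_tri_sub_lt hX hX' hc2.le).trans (by linarith)), ← hG.ncDeriv_eq hP hR hc2.le,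
    map_smul, ← smul_sub, map_smul_eq_mul, RCLike.norm_ofReal, abs_of_pos hc] at h
  refine le_of_mul_le_mul_left (h.trans (le_of_eq ?_)) hc
  set m := max (gnorm 𝕜 (X - R)) (gnorm 𝕜 (X' - R))
  calc 2 * M / δ * m = 8 * M / δ ^ 2 * m * (c * gnorm 𝕜 (X - X')) := by
        rw [hc1]; field_simp; ring
    _ = _ := by ring

/-- The derivative is Lipschitz in the point, with a constant that does not depend on the size. -/
theorem IsLocalNC.ncDeriv_close (hG : IsLocalNC 𝕜 Good G δ M) {P X R : Matrix ι ι V}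
    (hP : Good ι P) (hX : gnorm 𝕜 (X - P) < δ / 4) (hR : gnorm 𝕜 (R - P) < δ / 4)
    (Z : Matrix ι ι V) :
    gnorm 𝕜 (ncDeriv 𝕜 G δ X Z - ncDeriv 𝕜 G δ R Z) ≤
      8 * M / δ ^ 2 * gnorm 𝕜 (X - R) * gnorm 𝕜 Z := by
  have hδ := hG.delta_pos
  by_cases h0 : gnorm 𝕜 Z = 0
  · rw [eq_zero_of_gnorm 𝕜 h0]
    simp
  obtain ⟨c, hc, hc1, hc2⟩ := exists_smul_gnorm_eq (r := δ / 4) h0 (by linarith)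
  have h := hG.diffDiff_close hP hX hX hR hc2.le
  rw [← hG.ncDeriv_eq hP hX hc2.le, ← hG.ncDeriv_eq hP hR hc2.le,
    map_smul, map_smul, ← smul_sub, map_smul_eq_mul, RCLike.norm_ofReal, abs_of_pos hc,
    max_self] at h
  refine le_of_mul_le_mul_left (h.trans (le_of_eq ?_)) hc
  calc 2 * M / δ * gnorm 𝕜 (X - R) = 8 * M / δ ^ 2 * gnorm 𝕜 (X - R) * (c * gnorm 𝕜 Z) := by
        rw [hc1]; field_simp; ring
    _ = _ := by ring

theorem IsLocalNC.ncDeriv_reindex (hG : IsLocalNC 𝕜 Good G δ M) {P R : Matrix ι ι V}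
    (hP : Good ι P) (hR : gnorm 𝕜 (R - P) < δ / 4) (e : κ ≃ ι) (Z : Matrix ι ι V) :
    ncDeriv 𝕜 G δ (R.submatrix e e) (Z.submatrix e e) = (ncDeriv 𝕜 G δ R Z).submatrix e e := by
  classical
  have hδ := hG.delta_pos
  obtain ⟨c, hc, h⟩ := exists_smul_gnorm_le (𝕜 := 𝕜) Z (r := δ / 4) (by linarith)
  have hZ := h c hc.le le_rfl
  have hc0 : (c : 𝕜) ≠ 0 := RCLike.ofReal_ne_zero.2 hc.ne'
  have hR' : gnorm 𝕜 (R.submatrix e e - P.submatrix e e) < δ / 4 := by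
    exact (gnorm_reindex 𝕜 e (R - P)).trans_lt hR
  have hZ' : gnorm 𝕜 ((c : 𝕜) • Z.submatrix e e) ≤ δ / 4 :=
    (gnorm_reindex 𝕜 e ((c : 𝕜) • Z)).trans_le hZ
  have hPe := hG.good_reindex e hP
  have hsum : ∀ (f : κ → W) (j : ι), ∑ k, (if e k = j then (1 : 𝕜) else 0) • f k = f (e.symm j) := by
    intro f j
    simp [← Equiv.eq_symm_apply]
  have hI : Intertwines (R.submatrix e e)
      (Matrix.of fun i j => if e i = j then (1 : 𝕜) else 0) R := by
    intro i j
    simp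
    simp [← Equiv.eq_symm_apply]
  refine smul_right_injective _ hc0 ?_
  ext i j
  have := hG.diffDiff_intertwines hPe hP hR' hR' hZ' hR hR hZ hI hI
    (by intro i j; simp; simp [← Equiv.eq_symm_apply]) i (e j)
  rw [← hG.ncDeriv_eq hPe hR' hZ', ← hG.ncDeriv_eq hP hR hZ, map_smul, map_smul] at this
  simpa [hsum] using this

/-- The matrix with a single nonzero block `Z`, in position `(p, q)`. -/
def singleBlock (p q : κ) (Z : Matrix ι ι V) : Matrix (κ × ι) (κ × ι) V :=
  open Classical in Matrix.of fun x y => if x.1 = p ∧ y.1 = q then Z x.2 y.2 else 0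

variable (𝕜) (ι) in
/-- The block column with an identity matrix in position `l`. -/
def blockColumn (l : κ) : Matrix (κ × ι) ι 𝕜 :=
  open Classical in Matrix.of fun x j => if x = (l, j) then 1 else 0

omit [OperatorSpace 𝕜 V] in
theorem intertwines_blockColumn (R : Matrix ι ι V) (l : κ) :
    Intertwines (gamp κ R) (blockColumn 𝕜 ι l) R := by
  classical
  rintro ⟨i, i'⟩ j
  by_cases hil : i = l <;> simp [blockColumn, gamp, hil, Fintype.sum_prod_type, ite_and]

omit [Fintype ι] in
theorem sum_singleBlock (Z : Matrix (κ × ι) (κ × ι) V) :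
    Z = ∑ p, ∑ q, singleBlock p q (Matrix.of fun a b => Z (p, a) (q, b)) := by
  classical
  ext ⟨p, a⟩ ⟨q, b⟩
  simp [singleBlock, Matrix.sum_apply, ite_and]

theorem IsLocalNC.ncDeriv_singleBlock (hG : IsLocalNC 𝕜 Good G δ M) [Nonempty κ]
    {P R : Matrix ι ι V} (hP : Good ι P) (hR : gnorm 𝕜 (R - P) < δ / 4) (p q : κ)
    (Z : Matrix ι ι V) :
    ncDeriv 𝕜 G δ (gamp κ R) (singleBlock p q Z) = singleBlock p q (ncDeriv 𝕜 G δ R Z) := by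
  classical
  have hδ := hG.delta_pos
  obtain ⟨a, ha, h⟩ := exists_smul_gnorm_le (𝕜 := 𝕜) Z (r := δ / 4) (by linarith)
  obtain ⟨b, hb, h'⟩ := exists_smul_gnorm_le (𝕜 := 𝕜) (singleBlock p q Z) (r := δ / 4)
    (by linarith)
  set c := min a b
  have hc : 0 < c := lt_min ha hb
  have hZ := h c hc.le (min_le_left _ _)
  have hZ' := h' c hc.le (min_le_right _ _)
  have hc0 : (c : 𝕜) ≠ 0 := RCLike.ofReal_ne_zero.2 hc.ne'
  have hPe := hG.good_amp κ hP
  have hR' : gnorm 𝕜 (gamp κ R - gamp κ P) < δ / 4 := by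
    rw [← gamp_sub]
    exact (gnorm_gamp_le 𝕜 _).trans_lt hR
  -- by homogeneity it suffices to compare the derivatives at small arguments
  refine smul_right_injective _ hc0 ?_
  change (c : 𝕜) • _ = (c : 𝕜) • _
  ext ⟨i, i'⟩ ⟨l, j⟩
  by_cases hlq : l = q
  · have := hG.diffDiff_intertwines hPe hP hR' hR' hZ' hR hR hZ (intertwines_blockColumn R p)
      (intertwines_blockColumn R l)
      (by rintro ⟨x, x'⟩ j
          by_cases hx : x = p <;> simp [blockColumn, singleBlock, hlq, hx, Fintype.sum_prod_type, ite_and]) (i, i') j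
    rw [← hG.ncDeriv_eq hPe hR' hZ', ← hG.ncDeriv_eq hP hR hZ, map_smul, map_smul] at this
    by_cases hip : i = p
    · simpa [blockColumn, singleBlock, hlq, hip] using this
    · simpa [blockColumn, singleBlock, hlq, hip] using this
  · have h0 : gnorm 𝕜 (0 : Matrix ι ι V) ≤ δ / 4 := by rw [map_zero]; linarith
    have := hG.diffDiff_intertwines hPe hP hR' hR' hZ' hR hR h0 (intertwines_blockColumn R p)
      (intertwines_blockColumn R l)
      (by rintro ⟨x, x'⟩ j
          simp [blockColumn, singleBlock, Ne.symm hlq, Fintype.sum_prod_type, ite_and]) (i, i') j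
    rw [← hG.ncDeriv_eq hPe hR' hZ', ← hG.ncDeriv_eq hP hR h0, map_smul, map_zero] at this
    simpa [blockColumn, singleBlock, hlq] using this

/-- The derivative at an amplified point acts blockwise. -/
theorem IsLocalNC.ncDeriv_gamp (hG : IsLocalNC 𝕜 Good G δ M) [Nonempty κ]
    {P R : Matrix ι ι V} (hP : Good ι P) (hR : gnorm 𝕜 (R - P) < δ / 4)
    (Z : Matrix (κ × ι) (κ × ι) V) (p q : κ) (i j : ι) :
    ncDeriv 𝕜 G δ (gamp κ R) Z (p, i) (q, j) =
      ncDeriv 𝕜 G δ R (Matrix.of fun a b => Z (p, a) (q, b)) i j := by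
  classical
  conv_lhs => rw [sum_singleBlock Z]
  simp only [map_sum, hG.ncDeriv_singleBlock hP hR]
  simp [singleBlock, Matrix.sum_apply, ite_and]

end Calculus

/-! ### Completeness and fixed points -/

section Complete

variable {𝕜 V : Type*} [RCLike 𝕜] [AddCommGroup V] [Module 𝕜 V] [OperatorSpace 𝕜 V]
  {ι : Type} [Fintype ι]

theorem gnorm_complete (u : ℕ → Matrix ι ι V)
    (hu : ∀ ε > 0, ∃ N, ∀ p ≥ N, ∀ q ≥ N, gnorm 𝕜 (u p - u q) < ε) :
    ∃ X, Tendsto (fun p => gnorm 𝕜 (u p - X)) atTop (𝓝 0) := by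
  set e := (Fintype.equivFin ι).symm
  obtain ⟨X, hX⟩ := OperatorSpace.complete (𝕜 := 𝕜) _ (fun p => (u p).submatrix e e)
    (fun ε hε => hu ε hε)
  refine ⟨X.submatrix e.symm e.symm, ?_⟩
  have h : ∀ p, gnorm 𝕜 (u p - X.submatrix e.symm e.symm) =
      OperatorSpace.mnorm (𝕜 := 𝕜) _ ((u p).submatrix e e - X) := by
    intro p
    rw [gnorm_eq 𝕜 e]
    congr 1
    ext i j
    simp
  simpa only [h] using hX

/-- Banach's fixed point theorem on a ball, for the matrix norms of an operator space. -/
theorem exists_fixedPoint {Φ : Matrix ι ι V → Matrix ι ι V} {y₀ : Matrix ι ι V} {r : ℝ}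
    (hΦ : ∀ y y', gnorm 𝕜 (y - y₀) < r → gnorm 𝕜 (y' - y₀) < r →
      gnorm 𝕜 (Φ y - Φ y') ≤ 1 / 2 * gnorm 𝕜 (y - y'))
    (h₀ : 2 * gnorm 𝕜 (Φ y₀ - y₀) < r) : ∃ y, gnorm 𝕜 (y - y₀) < r ∧ Φ y = y := by
  set d := gnorm 𝕜 (Φ y₀ - y₀) with hd
  have hd0 : 0 ≤ d := apply_nonneg _ _
  have hr : 0 < r := by linarith
  have hy₀ : gnorm 𝕜 (y₀ - y₀) < r := by simpa using hr
  set u : ℕ → Matrix ι ι V := fun k => Φ^[k] y₀ with hu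
  have hus : ∀ k, u (k + 1) = Φ (u k) := fun k => Function.iterate_succ_apply' _ _ _
  have hA : ∀ j, gnorm 𝕜 (u j - y₀) ≤ 2 * d := by
    intro j
    induction j with
    | zero => simpa [hu] using hd0
    | succ j ih =>
      have h1 := hΦ (u j) y₀ (ih.trans_lt h₀) hy₀
      have h2 := map_add_le_add (gnorm 𝕜) (Φ (u j) - Φ y₀) (Φ y₀ - y₀)
      rw [sub_add_sub_cancel] at h2
      rw [hus]
      linarith
  have hlt : ∀ j, gnorm 𝕜 (u j - y₀) < r := fun j => (hA j).trans_lt h₀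
  have hB : ∀ k j, gnorm 𝕜 (u (k + j) - u k) ≤ (1 / 2) ^ k * (2 * d) := by
    intro k j
    induction k with
    | zero => simpa [hu] using hA j
    | succ k ih =>
      rw [Nat.succ_add, hus, hus]
      calc _ ≤ 1 / 2 * gnorm 𝕜 (u (k + j) - u k) := hΦ _ _ (hlt _) (hlt _)
        _ ≤ 1 / 2 * ((1 / 2) ^ k * (2 * d)) := by gcongr
        _ = _ := by ring
  have hlim : Tendsto (fun k : ℕ => (1 / 2 : ℝ) ^ k * (2 * d)) atTop (𝓝 0) := by
    simpa using (tendsto_pow_atTop_nhds_zero_of_lt_one (r := (1 / 2 : ℝ)) (by norm_num)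
      (by norm_num)).mul_const (2 * d)
  obtain ⟨y, hy⟩ := gnorm_complete (𝕜 := 𝕜) u (by
    intro ε hε
    obtain ⟨N, hN⟩ := (hlim.eventually (gt_mem_nhds (half_pos hε))).exists
    refine ⟨N, fun p hp q hq => ?_⟩
    obtain ⟨a, rfl⟩ := Nat.exists_eq_add_of_le hp
    obtain ⟨b, rfl⟩ := Nat.exists_eq_add_of_le hq
    have h1 := hB N a
    have h2 := hB N b
    rw [map_sub_rev] at h2
    have h3 := map_add_le_add (gnorm 𝕜) (u (N + a) - u N) (u N - u (N + b))
    rw [sub_add_sub_cancel] at h3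
    linarith)
  have hyr : gnorm 𝕜 (y - y₀) ≤ 2 * d := by
    refine ge_of_tendsto' (f := fun p => gnorm 𝕜 (u p - y) + 2 * d) (x := atTop)
      (by simpa using Tendsto.add_const (2 * d) hy) fun p => ?_
    have h3 := map_add_le_add (gnorm 𝕜) (y - u p) (u p - y₀)
    rw [sub_add_sub_cancel, map_sub_rev (gnorm 𝕜) y (u p)] at h3
    linarith [hA p]
  refine ⟨y, hyr.trans_lt h₀, ?_⟩
  have h0 : gnorm 𝕜 (Φ y - y) ≤ 0 := by
    refine ge_of_tendsto' (f := fun p => 1 / 2 * gnorm 𝕜 (u p - y) + gnorm 𝕜 (u (p + 1) - y))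
      (x := atTop) ?_ fun p => ?_
    · have h1 := (hy.const_mul (1 / 2 : ℝ)).add ((tendsto_add_atTop_iff_nat 1).2 hy)
      rwa [mul_zero, add_zero] at h1
    · have h1 := hΦ y (u p) (hyr.trans_lt h₀) (hlt p)
      have h3 := map_add_le_add (gnorm 𝕜) (Φ y - Φ (u p)) (u (p + 1) - y)
      rw [hus, sub_add_sub_cancel] at h3
      rw [map_sub_rev (gnorm 𝕜) y (u p)] at h1
      rw [hus]
      linarith
  exact sub_eq_zero.1 (eq_zero_of_gnorm 𝕜 (le_antisymm h0 (apply_nonneg _ _)))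

end Complete

/-! ### Matrices over a product -/

section Pairs

variable {𝕜 X Y : Type*} [RCLike 𝕜] [AddCommGroup X] [Module 𝕜 X] [AddCommGroup Y] [Module 𝕜 Y]
  {ι : Type} [Fintype ι]

/-- The matrix over `X × Y` with components `A` and `B`, for an arbitrary index type. -/
def gpair {X Y : Type*} {ι : Type} (A : Matrix ι ι X) (B : Matrix ι ι Y) : Matrix ι ι (X × Y) :=
  Matrix.of fun i j => (A i j, B i j)

omit [Fintype ι] in
theorem gpair_sub (A A' : Matrix ι ι X) (B B' : Matrix ι ι Y) :
    gpair A B - gpair A' B' = gpair (A - A') (B - B') := rfl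

theorem gnorm_gpair [OperatorSpace 𝕜 X] [OperatorSpace 𝕜 Y] (A : Matrix ι ι X) (B : Matrix ι ι Y) :
    gnorm 𝕜 (gpair A B) = max (gnorm 𝕜 A) (gnorm 𝕜 B) := rfl

variable (𝕜 X Y) in
/-- `A ↦ (A, 0)` on matrices. -/
def inlM (ι : Type) : Matrix ι ι X →ₗ[𝕜] Matrix ι ι (X × Y) := (LinearMap.inl 𝕜 X Y).mapMatrix

variable (𝕜 X Y) in
/-- `B ↦ (0, B)` on matrices. -/
def inrM (ι : Type) : Matrix ι ι Y →ₗ[𝕜] Matrix ι ι (X × Y) := (LinearMap.inr 𝕜 X Y).mapMatrix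

omit [Fintype ι] in
theorem inlM_apply (A : Matrix ι ι X) : inlM 𝕜 X Y ι A = gpair A 0 := rfl

omit [Fintype ι] in
theorem inrM_apply (B : Matrix ι ι Y) : inrM 𝕜 X Y ι B = gpair 0 B := rfl

omit [Fintype ι] in
theorem gpair_eq_add (A : Matrix ι ι X) (B : Matrix ι ι Y) :
    gpair A B = inlM 𝕜 X Y ι A + inrM 𝕜 X Y ι B := by
  ext i j <;> simp [inlM, inrM, gpair]

theorem gnorm_inlM [OperatorSpace 𝕜 X] [OperatorSpace 𝕜 Y] (A : Matrix ι ι X) :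
    gnorm 𝕜 (inlM 𝕜 X Y ι A) = gnorm 𝕜 A := by
  rw [inlM_apply, gnorm_gpair, map_zero, max_eq_left (apply_nonneg _ _)]

theorem gnorm_inrM [OperatorSpace 𝕜 X] [OperatorSpace 𝕜 Y] (B : Matrix ι ι Y) :
    gnorm 𝕜 (inrM 𝕜 X Y ι B) = gnorm 𝕜 B := by
  rw [inrM_apply, gnorm_gpair, map_zero, max_eq_right (apply_nonneg _ _)]

end Pairs

/-! ### The implicit equation near the centres -/

section Implicit

variable {𝕜 X Y Z : Type*} [RCLike 𝕜] [AddCommGroup X] [Module 𝕜 X] [OperatorSpace 𝕜 X]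
  [AddCommGroup Y] [Module 𝕜 Y] [OperatorSpace 𝕜 Y] [AddCommGroup Z] [Module 𝕜 Z]
  [OperatorSpace 𝕜 Z]

/-- The hypotheses of the implicit function theorem that do not depend on the size: `G` is a
bounded nc function near the centres, vanishes there, and its partial derivatives in the second
variable at the centres have inverses bounded by `C`. The radii `α ≤ β` are small enough for the
contraction argument. -/
structure IsImplicitData (𝕜 : Type*) {X Y Z : Type*} [RCLike 𝕜] [AddCommGroup X] [Module 𝕜 X]
    [OperatorSpace 𝕜 X] [AddCommGroup Y] [Module 𝕜 Y] [OperatorSpace 𝕜 Y] [AddCommGroup Z]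
    [Module 𝕜 Z] [OperatorSpace 𝕜 Z] (Good : ∀ ι : Type, Matrix ι ι (X × Y) → Prop)
    (G : ∀ ι : Type, Matrix ι ι (X × Y) → Matrix ι ι Z) (δ M C α β : ℝ) : Prop
    extends IsLocalNC 𝕜 Good G δ M where
  C_nonneg : 0 ≤ C
  map_center : ∀ {ι : Type} {P : Matrix ι ι (X × Y)}, Good ι P → G ι P = 0
  inverse : ∀ {ι : Type} [Fintype ι] {P : Matrix ι ι (X × Y)}, Good ι P →
    ∃ Λ : Matrix ι ι Z →ₗ[𝕜] Matrix ι ι Y,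
      (∀ B, Λ (ncDeriv 𝕜 G δ P (inrM 𝕜 X Y ι B)) = B) ∧
      (∀ A, ncDeriv 𝕜 G δ P (inrM 𝕜 X Y ι (Λ A)) = A) ∧ ∀ A, gnorm 𝕜 (Λ A) ≤ C * gnorm 𝕜 A
  alpha_pos : 0 < α
  alpha_le : α ≤ β
  beta_le : β ≤ δ / 4
  beta_small : C * (8 * M / δ ^ 2 * β) ≤ 1 / 2
  alpha_small : 4 * (C * (2 * M / δ)) * α ≤ β

variable {Good : ∀ ι : Type, Matrix ι ι (X × Y) → Prop}
    {G : ∀ ι : Type, Matrix ι ι (X × Y) → Matrix ι ι Z} {δ M C α β : ℝ}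
    {ι : Type} [Fintype ι] {x₀ : Matrix ι ι X} {y₀ : Matrix ι ι Y}

namespace IsImplicitData

theorem beta_pos (h : IsImplicitData 𝕜 Good G δ M C α β) : 0 < β := h.alpha_pos.trans_le h.alpha_le

theorem gpair_near (h : IsImplicitData 𝕜 Good G δ M C α β) {x : Matrix ι ι X} {y : Matrix ι ι Y}
    (hx : gnorm 𝕜 (x - x₀) < α) (hy : gnorm 𝕜 (y - y₀) < β) :
    gnorm 𝕜 (gpair x y - gpair x₀ y₀) < β := by
  rw [gpair_sub, gnorm_gpair]
  exact max_lt (hx.trans_le h.alpha_le) hy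

theorem center_near (h : IsImplicitData 𝕜 Good G δ M C α β) :
    gnorm 𝕜 (gpair x₀ y₀ - gpair x₀ y₀) < β := by
  simpa using h.beta_pos

/-- If `Λ` inverts the partial derivative at the centre, `y ↦ y - Λ (G (x, y))` is a contraction. -/
theorem contraction (h : IsImplicitData 𝕜 Good G δ M C α β) (hP : Good ι (gpair x₀ y₀))
    {Λ : Matrix ι ι Z →ₗ[𝕜] Matrix ι ι Y}
    (hΛ : ∀ B, Λ (ncDeriv 𝕜 G δ (gpair x₀ y₀) (inrM 𝕜 X Y ι B)) = B)
    (hΛC : ∀ A, gnorm 𝕜 (Λ A) ≤ C * gnorm 𝕜 A) {x : Matrix ι ι X} {y y' : Matrix ι ι Y}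
    (hx : gnorm 𝕜 (x - x₀) < α) (hy : gnorm 𝕜 (y - y₀) < β) (hy' : gnorm 𝕜 (y' - y₀) < β) :
    gnorm 𝕜 ((y - Λ (G ι (gpair x y))) - (y' - Λ (G ι (gpair x y')))) ≤
      1 / 2 * gnorm 𝕜 (y - y') := by
  have hM := h.bound_pos
  have hδ := h.delta_pos
  have hC := h.C_nonneg
  have hβ := h.beta_le
  have hy1 := h.gpair_near hx hy
  have hy2 := h.gpair_near hx hy'
  have hs := h.strict_deriv hP (hy1.trans_le hβ) (hy2.trans_le hβ) (h.center_near.trans_le hβ)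
  have hd : gpair x y - gpair x y' = inrM 𝕜 X Y ι (y - y') := by
    rw [gpair_sub, sub_self, inrM_apply]
  rw [hd, gnorm_inrM] at hs
  have he : (y - Λ (G ι (gpair x y))) - (y' - Λ (G ι (gpair x y'))) =
      - Λ (G ι (gpair x y) - G ι (gpair x y') -
        ncDeriv 𝕜 G δ (gpair x₀ y₀) (inrM 𝕜 X Y ι (y - y'))) := by
    rw [map_sub Λ, hΛ, map_sub]
    abel
  rw [he, map_neg_eq_map]
  calc _ ≤ C * _ := hΛC _
    _ ≤ C * (8 * M / δ ^ 2 * β * gnorm 𝕜 (y - y')) := by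
        gcongr
        refine hs.trans ?_
        gcongr
        exact (max_lt hy1 hy2).le
    _ = C * (8 * M / δ ^ 2 * β) * gnorm 𝕜 (y - y') := by ring
    _ ≤ _ := by
        gcongr
        exact h.beta_small

/-- `G (x, ·)` is bounded below, because `y ↦ y - Λ (G (x, y))` is a contraction. -/
theorem gnorm_sub_le (h : IsImplicitData 𝕜 Good G δ M C α β) (hP : Good ι (gpair x₀ y₀))
    {x : Matrix ι ι X} {y y' : Matrix ι ι Y}
    (hx : gnorm 𝕜 (x - x₀) < α) (hy : gnorm 𝕜 (y - y₀) < β) (hy' : gnorm 𝕜 (y' - y₀) < β) :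
    gnorm 𝕜 (y - y') ≤ 2 * C * gnorm 𝕜 (G ι (gpair x y) - G ι (gpair x y')) := by
  obtain ⟨Λ, hΛ, -, hΛC⟩ := h.inverse hP
  have h1 := h.contraction hP hΛ hΛC hx hy hy'
  have h2 := hΛC (G ι (gpair x y) - G ι (gpair x y'))
  have h3 := map_add_le_add (gnorm 𝕜) ((y - Λ (G ι (gpair x y))) - (y' - Λ (G ι (gpair x y'))))
    (Λ (G ι (gpair x y) - G ι (gpair x y')))
  rw [show (y - Λ (G ι (gpair x y))) - (y' - Λ (G ι (gpair x y'))) +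
    Λ (G ι (gpair x y) - G ι (gpair x y')) = y - y' by rw [map_sub]; abel] at h3
  linarith

theorem unique (h : IsImplicitData 𝕜 Good G δ M C α β) (hP : Good ι (gpair x₀ y₀))
    {x : Matrix ι ι X} {y y' : Matrix ι ι Y}
    (hx : gnorm 𝕜 (x - x₀) < α) (hy : gnorm 𝕜 (y - y₀) < β) (hy' : gnorm 𝕜 (y' - y₀) < β)
    (h0 : G ι (gpair x y) = 0) (h0' : G ι (gpair x y') = 0) : y = y' := by
  have h1 := h.gnorm_sub_le hP hx hy hy'
  rw [h0, h0', sub_zero, map_zero, mul_zero] at h1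
  exact sub_eq_zero.1 (eq_zero_of_gnorm 𝕜 (le_antisymm h1 (apply_nonneg _ _)))

theorem exists_zero (h : IsImplicitData 𝕜 Good G δ M C α β) (hP : Good ι (gpair x₀ y₀))
    {x : Matrix ι ι X} (hx : gnorm 𝕜 (x - x₀) < α) :
    ∃ y, gnorm 𝕜 (y - y₀) < β ∧ G ι (gpair x y) = 0 := by
  have hM := h.bound_pos
  have hδ := h.delta_pos
  have hC := h.C_nonneg
  have hβ := h.beta_le
  have hβ0 := h.beta_pos
  obtain ⟨Λ, hΛ, hΛ', hΛC⟩ := h.inverse hP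
  have hy₀ : gnorm 𝕜 (y₀ - y₀) < β := by simpa using hβ0
  obtain ⟨y, hy, hfix⟩ := exists_fixedPoint (𝕜 := 𝕜)
    (Φ := fun y => y - Λ (G ι (gpair x y))) (y₀ := y₀) (r := β)
    (fun y y' hy hy' => h.contraction hP hΛ hΛC hx hy hy') (by
      have h1 := h.lipschitz hP (X := gpair x y₀) (X' := gpair x₀ y₀)
        ((h.gpair_near hx hy₀).trans_le (by linarith)) (h.center_near.trans_le (by linarith))
      rw [h.map_center hP, sub_zero, gpair_sub, sub_self, ← inlM_apply (𝕜 := 𝕜),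
        gnorm_inlM] at h1
      have h2 : y₀ - Λ (G ι (gpair x y₀)) - y₀ = - Λ (G ι (gpair x y₀)) := by abel
      rw [h2, map_neg_eq_map]
      calc 2 * gnorm 𝕜 (Λ (G ι (gpair x y₀))) ≤ 2 * (C * (2 * M / δ * α)) := by
            gcongr
            refine (hΛC _).trans ?_
            gcongr
            refine h1.trans ?_
            gcongr
        _ = (4 * (C * (2 * M / δ)) * α) / 2 := by ring
        _ < β := by linarith [h.alpha_small])
  refine ⟨y, hy, ?_⟩
  have hΛ0 : Λ (G ι (gpair x y)) = 0 := by simpa using hfix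
  rw [← hΛ' (G ι (gpair x y)), hΛ0, map_zero, map_zero]

/-- Near the centre, `Λ` remains an approximate inverse of the partial derivative. -/
theorem gnorm_sub_ncDeriv_le (h : IsImplicitData 𝕜 Good G δ M C α β) (hP : Good ι (gpair x₀ y₀))
    {Λ : Matrix ι ι Z →ₗ[𝕜] Matrix ι ι Y}
    (hΛ : ∀ B, Λ (ncDeriv 𝕜 G δ (gpair x₀ y₀) (inrM 𝕜 X Y ι B)) = B)
    (hΛC : ∀ A, gnorm 𝕜 (Λ A) ≤ C * gnorm 𝕜 A) {R : Matrix ι ι (X × Y)}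
    (hR : gnorm 𝕜 (R - gpair x₀ y₀) < β) (B : Matrix ι ι Y) :
    gnorm 𝕜 (B - Λ (ncDeriv 𝕜 G δ R (inrM 𝕜 X Y ι B))) ≤ 1 / 2 * gnorm 𝕜 B := by
  have hM := h.bound_pos
  have hδ := h.delta_pos
  have hC := h.C_nonneg
  have hβ := h.beta_le
  have h1 := h.ncDeriv_close hP (hR.trans_le hβ) (h.center_near.trans_le hβ) (inrM 𝕜 X Y ι B)
  rw [gnorm_inrM] at h1
  have he : B - Λ (ncDeriv 𝕜 G δ R (inrM 𝕜 X Y ι B)) =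
      - Λ (ncDeriv 𝕜 G δ R (inrM 𝕜 X Y ι B) -
        ncDeriv 𝕜 G δ (gpair x₀ y₀) (inrM 𝕜 X Y ι B)) := by
    rw [map_sub Λ, hΛ]
    abel
  rw [he, map_neg_eq_map]
  calc _ ≤ C * _ := hΛC _
    _ ≤ C * (8 * M / δ ^ 2 * β * gnorm 𝕜 B) := by
        gcongr
        refine h1.trans ?_
        gcongr
    _ = C * (8 * M / δ ^ 2 * β) * gnorm 𝕜 B := by ring
    _ ≤ _ := by
        gcongr
        exact h.beta_small

/-- The partial derivatives in the second variable are bounded below near the centres, uniformly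
in the size. -/
theorem gnorm_le_ncDeriv (h : IsImplicitData 𝕜 Good G δ M C α β) (hP : Good ι (gpair x₀ y₀))
    {R : Matrix ι ι (X × Y)} (hR : gnorm 𝕜 (R - gpair x₀ y₀) < β) (B : Matrix ι ι Y) :
    gnorm 𝕜 B ≤ 2 * C * gnorm 𝕜 (ncDeriv 𝕜 G δ R (inrM 𝕜 X Y ι B)) := by
  obtain ⟨Λ, hΛ, -, hΛC⟩ := h.inverse hP
  have h1 := h.gnorm_sub_ncDeriv_le hP hΛ hΛC hR B
  have h2 := hΛC (ncDeriv 𝕜 G δ R (inrM 𝕜 X Y ι B))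
  have h3 := map_add_le_add (gnorm 𝕜) (B - Λ (ncDeriv 𝕜 G δ R (inrM 𝕜 X Y ι B)))
    (Λ (ncDeriv 𝕜 G δ R (inrM 𝕜 X Y ι B)))
  rw [sub_add_cancel] at h3
  linarith

theorem exists_partial_equiv (h : IsImplicitData 𝕜 Good G δ M C α β)
    (hP : Good ι (gpair x₀ y₀)) {R : Matrix ι ι (X × Y)}
    (hR : gnorm 𝕜 (R - gpair x₀ y₀) < β) :
    ∃ D : Matrix ι ι Y ≃ₗ[𝕜] Matrix ι ι Z,
      D.toLinearMap = ncDeriv 𝕜 G δ R ∘ₗ inrM 𝕜 X Y ι := by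
  obtain ⟨Λ, hΛ, hΛ', hΛC⟩ := h.inverse hP
  refine ⟨LinearEquiv.ofBijective (ncDeriv 𝕜 G δ R ∘ₗ inrM 𝕜 X Y ι) ⟨?_, ?_⟩, rfl⟩
  · refine (injective_iff_map_eq_zero _).2 fun B hB => ?_
    have h1 := h.gnorm_le_ncDeriv hP hR B
    rw [show ncDeriv 𝕜 G δ R (inrM 𝕜 X Y ι B) = 0 from hB, map_zero, mul_zero] at h1
    exact eq_zero_of_gnorm 𝕜 (le_antisymm h1 (apply_nonneg _ _))
  · intro A
    -- a solution is a fixed point of the contraction `B ↦ B - Λ (D B - A)`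
    obtain ⟨B, -, hB⟩ := exists_fixedPoint (𝕜 := 𝕜)
      (Φ := fun B => B - Λ (ncDeriv 𝕜 G δ R (inrM 𝕜 X Y ι B) - A)) (y₀ := 0)
      (r := 2 * gnorm 𝕜 (Λ A) + 1) (fun B B' _ _ => by
        refine le_trans (le_of_eq ?_) (h.gnorm_sub_ncDeriv_le hP hΛ hΛC hR (B - B'))
        congr 1
        simp only [map_sub]
        abel) (by simp)
    refine ⟨B, ?_⟩
    have h0 : Λ (ncDeriv 𝕜 G δ R (inrM 𝕜 X Y ι B) - A) = 0 := by simpa using hB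
    have h1 := hΛ' (ncDeriv 𝕜 G δ R (inrM 𝕜 X Y ι B) - A)
    rw [h0, map_zero, map_zero] at h1
    exact (sub_eq_zero.1 h1.symm)

/-- The implicit function is Lipschitz. -/
theorem gnorm_zero_sub_le (h : IsImplicitData 𝕜 Good G δ M C α β) (hP : Good ι (gpair x₀ y₀))
    {x x' : Matrix ι ι X} {y y' : Matrix ι ι Y}
    (hx : gnorm 𝕜 (x - x₀) < α) (hx' : gnorm 𝕜 (x' - x₀) < α)
    (hy : gnorm 𝕜 (y - y₀) < β) (hy' : gnorm 𝕜 (y' - y₀) < β)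
    (h0 : G ι (gpair x y) = 0) (h0' : G ι (gpair x' y') = 0) :
    gnorm 𝕜 (y - y') ≤ 2 * C * (2 * M / δ) * gnorm 𝕜 (x - x') := by
  have hδ := h.delta_pos
  have hC := h.C_nonneg
  have hβ := h.beta_le
  have h1 := h.gnorm_sub_le hP hx hy hy'
  have h2 := h.lipschitz hP (X := gpair x y') (X' := gpair x' y')
    ((h.gpair_near hx hy').trans_le (by linarith)) ((h.gpair_near hx' hy').trans_le (by linarith))
  rw [h0', sub_zero, gpair_sub, sub_self, ← inlM_apply (𝕜 := 𝕜), gnorm_inlM] at h2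
  rw [h0, zero_sub, map_neg_eq_map] at h1
  calc _ ≤ 2 * C * gnorm 𝕜 (G ι (gpair x y')) := h1
    _ ≤ 2 * C * (2 * M / δ * gnorm 𝕜 (x - x')) := by gcongr
    _ = _ := by ring

/-- The implicit function satisfies the differentiated equation up to second order. -/
theorem gnorm_implicit_deriv_le (h : IsImplicitData 𝕜 Good G δ M C α β)
    (hP : Good ι (gpair x₀ y₀)) {x x' : Matrix ι ι X} {y y' : Matrix ι ι Y}
    (hx : gnorm 𝕜 (x - x₀) < α) (hx' : gnorm 𝕜 (x' - x₀) < α)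
    (hy : gnorm 𝕜 (y - y₀) < β) (hy' : gnorm 𝕜 (y' - y₀) < β)
    (h0 : G ι (gpair x y) = 0) (h0' : G ι (gpair x' y') = 0)
    {D : Matrix ι ι Y ≃ₗ[𝕜] Matrix ι ι Z}
    (hD : D.toLinearMap = ncDeriv 𝕜 G δ (gpair x y) ∘ₗ inrM 𝕜 X Y ι) :
    gnorm 𝕜 (y' - y + D.symm (ncDeriv 𝕜 G δ (gpair x y) (inlM 𝕜 X Y ι (x' - x)))) ≤
      2 * C * (8 * M / δ ^ 2) * max 1 (2 * C * (2 * M / δ)) ^ 2 * gnorm 𝕜 (x' - x) ^ 2 := by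
  have hM := h.bound_pos
  have hδ := h.delta_pos
  have hC := h.C_nonneg
  have hβ := h.beta_le
  have h1 := h.gnorm_le_ncDeriv hP (h.gpair_near hx hy)
    (y' - y + D.symm (ncDeriv 𝕜 G δ (gpair x y) (inlM 𝕜 X Y ι (x' - x))))
  have hD' : ∀ b, ncDeriv 𝕜 G δ (gpair x y) (inrM 𝕜 X Y ι b) = D b :=
    fun b => (LinearMap.congr_fun hD b).symm
  rw [hD', map_add D, LinearEquiv.apply_symm_apply, ← hD', ← map_add,
    add_comm (inrM 𝕜 X Y ι (y' - y)), ← gpair_eq_add, ← gpair_sub] at h1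
  have h2 := h.strict_deriv hP ((h.gpair_near hx' hy').trans_le hβ)
    ((h.gpair_near hx hy).trans_le hβ) ((h.gpair_near hx hy).trans_le hβ)
  rw [h0, h0', sub_zero, zero_sub, map_neg_eq_map, sub_self, map_zero,
    max_eq_left (apply_nonneg _ _)] at h2
  have h3 : gnorm 𝕜 (gpair x' y' - gpair x y) ≤
      max 1 (2 * C * (2 * M / δ)) * gnorm 𝕜 (x' - x) := by
    rw [gpair_sub, gnorm_gpair]
    refine max_le ?_ ?_
    · exact le_mul_of_one_le_left (apply_nonneg _ _) (le_max_left _ _)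
    · refine (h.gnorm_zero_sub_le hP hx' hx hy' hy h0' h0).trans ?_
      gcongr
      exact le_max_right _ _
  have h4 : (0 : ℝ) ≤ gnorm 𝕜 (gpair x' y' - gpair x y) := apply_nonneg _ _
  calc _ ≤ _ := h1
    _ ≤ 2 * C * (8 * M / δ ^ 2 * (max 1 (2 * C * (2 * M / δ)) * gnorm 𝕜 (x' - x)) *
        (max 1 (2 * C * (2 * M / δ)) * gnorm 𝕜 (x' - x))) := by
      gcongr
      refine h2.trans ?_
      gcongr
    _ = _ := by ring

end IsImplicitData

end Implicit

/-! ### Directional derivatives -/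

section DirDeriv

variable {𝕜 V W : Type*} [RCLike 𝕜] [AddCommGroup V] [Module 𝕜 V] [OperatorSpace 𝕜 V]
  [AddCommGroup W] [Module 𝕜 W] [OperatorSpace 𝕜 W] {n : ℕ}

theorem tendsto_smul_gnorm (Z : Matrix (Fin n) (Fin n) V) :
    Tendsto (fun t : 𝕜 => gnorm 𝕜 (t • Z)) (𝓝 0) (𝓝 0) := by
  simp only [map_smul_eq_mul]
  have : Tendsto (fun t : 𝕜 => ‖t‖ * gnorm 𝕜 Z) (𝓝 0) (𝓝 (‖(0 : 𝕜)‖ * gnorm 𝕜 Z)) :=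
    (continuous_norm.tendsto _).mul_const _
  simpa using this

theorem eventually_add_smul_near {X P Z : Matrix (Fin n) (Fin n) V} {r : ℝ}
    (hX : gnorm 𝕜 (X - P) < r) : ∀ᶠ t : 𝕜 in 𝓝 0, gnorm 𝕜 (X + t • Z - P) < r := by
  filter_upwards [(tendsto_smul_gnorm (𝕜 := 𝕜) Z).eventually (gt_mem_nhds (sub_pos.2 hX))] with t ht
  have := map_add_le_add (gnorm 𝕜) (X - P) (t • Z)
  rw [show X + t • Z - P = X - P + t • Z by abel]
  linarith

/-- A second order bound on the remainder yields the directional derivative. -/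
theorem hasDirDeriv_of_quadratic {g : Matrix (Fin n) (Fin n) V → Matrix (Fin n) (Fin n) W}
    {X Z : Matrix (Fin n) (Fin n) V} {D : Matrix (Fin n) (Fin n) W} {E : ℝ}
    (h : ∀ᶠ t : 𝕜 in 𝓝 0, gnorm 𝕜 (g (X + t • Z) - g X - t • D) ≤ E * gnorm 𝕜 (t • Z) ^ 2) :
    HasDirDeriv 𝕜 g X Z D := by
  have hlim : Tendsto (fun t : 𝕜 => E * gnorm 𝕜 Z * gnorm 𝕜 (t • Z)) (𝓝[≠] 0) (𝓝 0) := by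
    simpa using ((tendsto_smul_gnorm (𝕜 := 𝕜) Z).const_mul (E * gnorm 𝕜 Z)).mono_left
      nhdsWithin_le_nhds
  refine squeeze_zero' (Eventually.of_forall fun t => apply_nonneg _ _) ?_ hlim
  filter_upwards [h.filter_mono nhdsWithin_le_nhds, self_mem_nhdsWithin] with t ht ht0
  have ht0' : t ≠ 0 := ht0
  have h1 : t⁻¹ • (g (X + t • Z) - g X) - D = t⁻¹ • (g (X + t • Z) - g X - t • D) := by
    rw [smul_sub t⁻¹ _ (t • D), smul_smul, inv_mul_cancel₀ ht0', one_smul]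
  rw [h1, map_smul_eq_mul, ← gnorm_fin, norm_inv]
  rw [map_smul_eq_mul] at ht ⊢
  have : 0 < ‖t‖ := norm_pos_iff.2 ht0'
  rw [inv_mul_le_iff₀ this]
  calc _ ≤ _ := ht
    _ = _ := by ring

omit [OperatorSpace 𝕜 V] in
theorem HasDirDeriv.unique {g : Matrix (Fin n) (Fin n) V → Matrix (Fin n) (Fin n) W}
    {X Z : Matrix (Fin n) (Fin n) V} {D D' : Matrix (Fin n) (Fin n) W}
    (h : HasDirDeriv 𝕜 g X Z D) (h' : HasDirDeriv 𝕜 g X Z D') : D = D' := by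
  have h1 := h.add h'
  rw [add_zero] at h1
  have h2 : OperatorSpace.mnorm (𝕜 := 𝕜) n (D - D') ≤ 0 := by
    refine ge_of_tendsto h1 (Eventually.of_forall fun t => ?_)
    set q := t⁻¹ • (g (X + t • Z) - g X)
    have h3 := map_add_le_add (OperatorSpace.mnorm (𝕜 := 𝕜) n) (D - q) (q - D')
    rw [sub_add_sub_cancel, map_sub_rev _ D q] at h3
    exact h3
  exact sub_eq_zero.1 (OperatorSpace.eq_zero_of_mnorm n _ (le_antisymm h2 (apply_nonneg _ _)))

omit [OperatorSpace 𝕜 V] in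
theorem HasDirDeriv.congr {g g' : Matrix (Fin n) (Fin n) V → Matrix (Fin n) (Fin n) W}
    {X Z : Matrix (Fin n) (Fin n) V} {D : Matrix (Fin n) (Fin n) W}
    (h : HasDirDeriv 𝕜 g X Z D) (h0 : g X = g' X)
    (hg : ∀ᶠ t : 𝕜 in 𝓝 0, g (X + t • Z) = g' (X + t • Z)) : HasDirDeriv 𝕜 g' X Z D := by
  refine Tendsto.congr' ?_ h
  filter_upwards [hg.filter_mono nhdsWithin_le_nhds] with t ht
  rw [ht, h0]

theorem IsLocalNC.hasDirDeriv {Good : ∀ ι : Type, Matrix ι ι V → Prop}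
    {G : ∀ ι : Type, Matrix ι ι V → Matrix ι ι W} {δ M : ℝ} (hG : IsLocalNC 𝕜 Good G δ M)
    {P R : Matrix (Fin n) (Fin n) V} (hP : Good (Fin n) P) (hR : gnorm 𝕜 (R - P) < δ / 4)
    (Z : Matrix (Fin n) (Fin n) V) : HasDirDeriv 𝕜 (G (Fin n)) R Z (ncDeriv 𝕜 G δ R Z) := by
  refine hasDirDeriv_of_quadratic (E := 8 * M / δ ^ 2) ?_
  filter_upwards [eventually_add_smul_near (Z := Z) hR] with t ht
  have h := hG.strict_deriv hP ht hR hR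
  rw [add_sub_cancel_left, sub_self, map_zero, max_eq_left (apply_nonneg _ _), map_smul] at h
  refine h.trans (le_of_eq (by ring))

end DirDeriv

/-! ### Amplifications and nc balls -/

section Amplification

variable {V : Type*} {s : ℕ}

theorem amp_finProdFinEquiv [Zero V] {m : ℕ} (Y : Matrix (Fin s) (Fin s) V) (a b : Fin m)
    (c d : Fin s) :
    amp m Y (finProdFinEquiv (a, c)) (finProdFinEquiv (b, d)) = if a = b then Y c d else 0 := by
  simp [amp]

theorem amp_eq_gamp [Zero V] {m : ℕ} (Y : Matrix (Fin s) (Fin s) V) :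
    amp m Y = (gamp (Fin m) Y).submatrix finProdFinEquiv.symm finProdFinEquiv.symm := by
  ext i j
  simp [amp, gamp]

theorem amp_sub [AddCommGroup V] {m : ℕ} (Y Y' : Matrix (Fin s) (Fin s) V) :
    amp m (Y - Y') = amp m Y - amp m Y' := by
  ext i j
  simp only [amp, Matrix.reindex_apply, Matrix.submatrix_apply, Matrix.of_apply, Matrix.sub_apply]
  split_ifs <;> simp

theorem pair_amp [Zero V] {W : Type*} [Zero W] {m : ℕ} (X : Matrix (Fin s) (Fin s) V)
    (Y : Matrix (Fin s) (Fin s) W) : gpair (amp m X) (amp m Y) = amp m (pair X Y) := by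
  ext i j <;> simp only [amp, gpair, pair, Matrix.reindex_apply, Matrix.submatrix_apply,
    Matrix.of_apply] <;> split_ifs <;> rfl

/-- The equality `(Y^(m))^(k) = Y^(km)`, up to the identification of the index types. -/
theorem amp_amp [Zero V] (k m : ℕ) (Y : Matrix (Fin s) (Fin s) V) :
    (amp (k * m) Y).submatrix (finCongr (mul_assoc k m s).symm) (finCongr (mul_assoc k m s).symm) =
      amp k (amp m Y) := by
  have h : ∀ (a : Fin k) (b : Fin m) (c : Fin s),
      finCongr (mul_assoc k m s).symm (finProdFinEquiv (a, finProdFinEquiv (b, c))) =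
        finProdFinEquiv (finProdFinEquiv (a, b), c) := by
    intro a b c
    ext
    simp
    ring
  ext i j
  obtain ⟨⟨a, x⟩, rfl⟩ := finProdFinEquiv.surjective i
  obtain ⟨⟨a', x'⟩, rfl⟩ := finProdFinEquiv.surjective j
  obtain ⟨⟨b, c⟩, rfl⟩ := finProdFinEquiv.surjective x
  obtain ⟨⟨b', c'⟩, rfl⟩ := finProdFinEquiv.surjective x'
  simp only [Matrix.submatrix_apply, h, amp_finProdFinEquiv, EmbeddingLike.apply_eq_iff_eq,
    Prod.mk.injEq, ite_and]

/-- The equality `Y^(m) ⊕ Y^(m') = Y^(m + m')`, up to the identification of the index types. -/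
theorem dsum_amp [Zero V] (m m' : ℕ) (Y : Matrix (Fin s) (Fin s) V) :
    (amp (m + m') Y).submatrix (finCongr (add_mul m m' s).symm) (finCongr (add_mul m m' s).symm) =
      dsum (amp m Y) (amp m' Y) := by
  have h : ∀ (a : Fin m) (c : Fin s), finCongr (add_mul m m' s).symm
      (Fin.castAdd (m' * s) (finProdFinEquiv (a, c))) =
        finProdFinEquiv (Fin.castAdd m' a, c) := by
    intro a c
    ext
    simp
  have h' : ∀ (a : Fin m') (c : Fin s), finCongr (add_mul m m' s).symm
      (Fin.natAdd (m * s) (finProdFinEquiv (a, c))) =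
        finProdFinEquiv (Fin.natAdd m a, c) := by
    intro a c
    ext
    simp
    ring
  ext i j
  refine Fin.addCases (fun i => ?_) (fun i => ?_) i <;>
    refine Fin.addCases (fun j => ?_) (fun j => ?_) j <;>
    obtain ⟨⟨a, c⟩, rfl⟩ := finProdFinEquiv.surjective i <;>
    obtain ⟨⟨b, d⟩, rfl⟩ := finProdFinEquiv.surjective j <;>
    simp only [Matrix.submatrix_apply, h, h', amp_finProdFinEquiv] <;>
    simp [dsum, amp_finProdFinEquiv, Fin.ext_iff]
  · intro h
    have := a.isLt
    omega
  · intro h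
    have := b.isLt
    omega

variable (P₀ : Matrix (Fin s) (Fin s) V)

/-- `P` is, up to a numbering of the index type, an amplification of `P₀`. -/
def IsAmp [Zero V] (ι : Type) (P : Matrix ι ι V) : Prop :=
  ∃ (κ : Type) (_ : Fintype κ) (_ : Nonempty κ) (e : ι ≃ κ × Fin s),
    P = (gamp κ P₀).submatrix e e

variable {P₀} {ι κ : Type}

theorem IsAmp.sum [Zero V] {P : Matrix ι ι V} {Q : Matrix κ κ V} (hP : IsAmp P₀ ι P)
    (hQ : IsAmp P₀ κ Q) : IsAmp P₀ (ι ⊕ κ) (Matrix.fromBlocks P 0 0 Q) := by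
  obtain ⟨a, _, _, e, rfl⟩ := hP
  obtain ⟨b, _, _, g, rfl⟩ := hQ
  refine ⟨a ⊕ b, inferInstance, inferInstance,
    (Equiv.sumCongr e g).trans (Equiv.sumProdDistrib a b (Fin s)).symm, ?_⟩
  ext (i | i) (j | j)
  · by_cases h : (e i).1 = (e j).1 <;> simp [gamp, h]
  · simp [gamp]
  · simp [gamp]
  · by_cases h : (g i).1 = (g j).1 <;> simp [gamp, h]

theorem IsAmp.gamp [Zero V] {P : Matrix ι ι V} (κ : Type) [Fintype κ] [Nonempty κ]
    (hP : IsAmp P₀ ι P) : IsAmp P₀ (κ × ι) (gamp κ P) := by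
  obtain ⟨a, _, _, e, rfl⟩ := hP
  refine ⟨κ × a, inferInstance, inferInstance,
    (Equiv.prodCongr (Equiv.refl κ) e).trans (Equiv.prodAssoc κ a (Fin s)).symm, ?_⟩
  ext i j
  by_cases h : i.1 = j.1 <;> by_cases h' : (e i.2).1 = (e j.2).1 <;>
    simp [NCFun.gamp, Prod.ext_iff, h, h']

theorem IsAmp.reindex [Zero V] {P : Matrix ι ι V} (e : κ ≃ ι) (hP : IsAmp P₀ ι P) :
    IsAmp P₀ κ (P.submatrix e e) := by
  obtain ⟨a, h1, h2, g, rfl⟩ := hP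
  exact ⟨a, h1, h2, e.trans g, rfl⟩

theorem isAmp_amp [Zero V] {m : ℕ} (hm : 0 < m) : IsAmp P₀ (Fin (m * s)) (amp m P₀) :=
  ⟨Fin m, inferInstance, ⟨⟨0, hm⟩⟩, finProdFinEquiv.symm, amp_eq_gamp P₀⟩

theorem isAmp_self [Zero V] : IsAmp P₀ (Fin s) P₀ :=
  ⟨Unit, inferInstance, inferInstance, (Equiv.uniqueProd (Fin s) Unit).symm, by
    ext i j; simp [NCFun.gamp]⟩

/-- A numbering of `κ × Fin s` compatible with the block structure of `amp`. -/
def ampEquiv (κ : Type) [Fintype κ] (s : ℕ) : Fin (Fintype.card κ * s) ≃ κ × Fin s :=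
  finProdFinEquiv.symm.trans (Equiv.prodCongr (Fintype.equivFin κ).symm (Equiv.refl (Fin s)))

theorem gamp_submatrix_ampEquiv [Zero V] (κ : Type) [Fintype κ] (P : Matrix (Fin s) (Fin s) V) :
    (NCFun.gamp κ P).submatrix (ampEquiv κ s) (ampEquiv κ s) = amp (Fintype.card κ) P := by
  ext i j
  simp [NCFun.gamp, ampEquiv, amp]

end Amplification

section Balls

variable {𝕜 V W : Type*} [RCLike 𝕜] [AddCommGroup V] [Module 𝕜 V] [AddCommGroup W]
  [Module 𝕜 W] [OperatorSpace 𝕜 V] [OperatorSpace 𝕜 W] {s : ℕ}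

theorem gnorm_amp_le (m : ℕ) (Y : Matrix (Fin s) (Fin s) V) :
    gnorm 𝕜 (amp m Y) ≤ gnorm 𝕜 Y := by
  rw [amp_eq_gamp, gnorm_reindex]
  exact gnorm_gamp_le 𝕜 Y

theorem mem_ampBall {Y : Matrix (Fin s) (Fin s) V} {r : ℝ} {m : ℕ}
    {X : Matrix (Fin (m * s)) (Fin (m * s)) V} :
    X ∈ ampBall 𝕜 Y r m ↔ gnorm 𝕜 (X - amp m Y) < r := by
  rw [gnorm_fin]
  rfl

theorem mem_level_ncBall {Y : Matrix (Fin s) (Fin s) V} {r : ℝ} {m : ℕ} (hs : 0 < s) (hm : 0 < m)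
    {X : Matrix (Fin (m * s)) (Fin (m * s)) V} :
    X ∈ level (ncBall 𝕜 Y r) (m * s) ↔ gnorm 𝕜 (X - amp m Y) < r := by
  rw [← mem_ampBall]
  constructor
  · rintro ⟨hn, m', hm', X', hX', h⟩
    rw [NCSpace.mk.injEq] at h
    obtain ⟨h1, h2⟩ := h
    obtain rfl := Nat.eq_of_mul_eq_mul_right hs h1
    obtain rfl := eq_of_heq h2
    exact hX'
  · intro h
    exact ⟨Nat.mul_pos hm hs, m, Nat.mul_pos hm hs, X, h, rfl⟩

theorem exists_of_mem_level_ncBall {Y : Matrix (Fin s) (Fin s) V} {r : ℝ} {n : ℕ}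
    {X : Matrix (Fin n) (Fin n) V} (h : X ∈ level (ncBall 𝕜 Y r) n) :
    ∃ m, 0 < m ∧ 0 < s ∧ n = m * s := by
  obtain ⟨hn, m, hm, X', hX', h⟩ := h
  rw [NCSpace.mk.injEq] at h
  exact ⟨m, Nat.pos_of_mul_pos_right hm, Nat.pos_of_mul_pos_left hm, h.1⟩

theorem mem_level_cast {𝕜 V : Type*} {Ω : Set (NCSpace 𝕜 V)} {n m : ℕ} (h : m = n)
    {X : Matrix (Fin n) (Fin n) V} :
    X.submatrix (finCongr h) (finCongr h) ∈ level Ω m ↔ X ∈ level Ω n := by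
  subst h
  rfl

theorem ncBall_mono {Y : Matrix (Fin s) (Fin s) V} {r r' : ℝ} (h : r ≤ r') :
    ncBall 𝕜 Y r ⊆ ncBall 𝕜 Y r' := by
  rintro p ⟨m, hm, X, hX, rfl⟩
  exact ⟨m, hm, X, lt_of_lt_of_le hX h, rfl⟩

theorem isNCSet_ncBall (Y : Matrix (Fin s) (Fin s) V) (r : ℝ) : IsNCSet (ncBall 𝕜 Y r) := by
  intro n n' X hX X' hX'
  obtain ⟨m, hm, hs, rfl⟩ := exists_of_mem_level_ncBall hX
  obtain ⟨m', hm', -, rfl⟩ := exists_of_mem_level_ncBall hX'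
  rw [mem_level_ncBall hs hm] at hX
  rw [mem_level_ncBall hs hm'] at hX'
  have he : dsum X X' - dsum (amp m Y) (amp m' Y) = dsum (X - amp m Y) (X' - amp m' Y) := by
    ext i j
    refine Fin.addCases (fun i => ?_) (fun i => ?_) i <;>
      refine Fin.addCases (fun j => ?_) (fun j => ?_) j <;> simp [dsum]
  rw [← mem_level_cast (add_mul m m' s), mem_level_ncBall hs (Nat.add_pos_left hm m'),
    ← gnorm_reindex 𝕜 (finCongr (add_mul m m' s).symm)]
  have h2 : ((dsum X X').submatrix (finCongr (add_mul m m' s)) (finCongr (add_mul m m' s)) -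
      amp (m + m') Y).submatrix (finCongr (add_mul m m' s).symm) (finCongr (add_mul m m' s).symm) =
      dsum (X - amp m Y) (X' - amp m' Y) := by
    rw [← he, ← dsum_amp]
    rfl
  rw [h2, gnorm_fin, OperatorSpace.mnorm_dsum, ← gnorm_fin, ← gnorm_fin]
  exact max_lt hX hX'

/-- A point of an nc ball is the centre of an nc ball inside it. -/
theorem exists_ncBall_subset_ncBall {Y : Matrix (Fin s) (Fin s) V} {r : ℝ} {n : ℕ}
    {X : Matrix (Fin n) (Fin n) V} (hX : X ∈ level (ncBall 𝕜 Y r) n) :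
    ∃ ε > 0, ncBall 𝕜 X ε ⊆ ncBall 𝕜 Y r := by
  obtain ⟨m, hm, hs, rfl⟩ := exists_of_mem_level_ncBall hX
  rw [mem_level_ncBall hs hm] at hX
  refine ⟨r - gnorm 𝕜 (X - amp m Y), sub_pos.2 hX, ?_⟩
  rintro p ⟨k, hk, X', hX', rfl⟩
  have hk0 : 0 < k := Nat.pos_of_mul_pos_right hk
  rw [mem_ampBall] at hX'
  suffices X' ∈ level (ncBall 𝕜 Y r) (k * (m * s)) from this.2
  rw [← mem_level_cast (mul_assoc k m s), mem_level_ncBall hs (Nat.mul_pos hk0 hm),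
    ← gnorm_reindex 𝕜 (finCongr (mul_assoc k m s).symm)]
  have h2 : (X'.submatrix (finCongr (mul_assoc k m s)) (finCongr (mul_assoc k m s)) -
      amp (k * m) Y).submatrix (finCongr (mul_assoc k m s).symm)
        (finCongr (mul_assoc k m s).symm) =
      (X' - amp k X) + amp k (X - amp m Y) := by
    rw [amp_sub, sub_add_sub_cancel, ← amp_amp]
    rfl
  rw [h2]
  have h3 := map_add_le_add (gnorm 𝕜) (X' - amp k X) (amp k (X - amp m Y))
  have h4 := gnorm_amp_le (𝕜 := 𝕜) k (X - amp m Y)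
  linarith

/-- Around each of its points, a uniformly open set contains an nc ball. -/
theorem exists_ncBall_subset_of_isOpen {Ω : Set (NCSpace 𝕜 V)} (hΩ : IsOpen Ω) {n : ℕ}
    {X : Matrix (Fin n) (Fin n) V} (hX : X ∈ level Ω n) : ∃ ε > 0, ncBall 𝕜 X ε ⊆ Ω := by
  induction hΩ with
  | basic B hB =>
    obtain ⟨s, Y, r, -, -, rfl⟩ := hB
    exact exists_ncBall_subset_ncBall hX
  | univ => exact ⟨1, one_pos, Set.subset_univ _⟩
  | inter A B _ _ hA hB =>
    obtain ⟨hn, h1, h2⟩ := hX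
    obtain ⟨a, ha, hA⟩ := hA ⟨hn, h1⟩
    obtain ⟨b, hb, hB⟩ := hB ⟨hn, h2⟩
    exact ⟨min a b, lt_min ha hb, Set.subset_inter ((ncBall_mono (min_le_left a b)).trans hA)
      ((ncBall_mono (min_le_right a b)).trans hB)⟩
  | sUnion S _ ih =>
    obtain ⟨hn, A, hA, hXA⟩ := hX
    obtain ⟨ε, hε, h⟩ := ih A hA ⟨hn, hXA⟩
    exact ⟨ε, hε, h.trans (Set.subset_sUnion_of_mem hA)⟩

theorem isOpen_ncBall {Y : Matrix (Fin s) (Fin s) V} {r : ℝ} (hs : 0 < s) (hr : 0 < r) :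
    IsOpen (ncBall 𝕜 Y r) :=
  TopologicalSpace.isOpen_generateFrom_of_mem ⟨s, Y, r, hs, hr, rfl⟩

theorem mem_level_ncBall_of_gnorm_lt {n : ℕ} {Y X : Matrix (Fin n) (Fin n) V} {r : ℝ} (hn : 0 < n)
    (hX : gnorm 𝕜 (X - Y) < r) : X ∈ level (ncBall 𝕜 Y r) n := by
  rw [← mem_level_cast (one_mul n), mem_level_ncBall hn one_pos]
  have : amp 1 Y = Y.submatrix (finCongr (one_mul n)) (finCongr (one_mul n)) := by
    have h : ∀ (a : Fin 1) (c : Fin n), finCongr (one_mul n) (finProdFinEquiv (a, c)) = c := by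
      intro a c
      ext
      simp
    ext i j
    obtain ⟨⟨a, c⟩, rfl⟩ := finProdFinEquiv.surjective i
    obtain ⟨⟨b, d⟩, rfl⟩ := finProdFinEquiv.surjective j
    rw [amp_finProdFinEquiv, if_pos (Subsingleton.elim a b), Matrix.submatrix_apply, h, h]
  rw [this]
  exact (gnorm_reindex 𝕜 (finCongr (one_mul n)) (X - Y)).trans_lt hX

theorem self_mem_ncBall {n : ℕ} {Y : Matrix (Fin n) (Fin n) V} {r : ℝ} (hn : 0 < n) (hr : 0 < r) :
    Y ∈ level (ncBall 𝕜 Y r) n :=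
  mem_level_ncBall_of_gnorm_lt hn (by simpa using hr)

theorem eventually_mem_level {Ω : Set (NCSpace 𝕜 V)} (hΩ : IsOpen Ω) {n : ℕ}
    {X : Matrix (Fin n) (Fin n) V} (hX : X ∈ level Ω n) (Z : Matrix (Fin n) (Fin n) V) :
    ∀ᶠ t : 𝕜 in 𝓝 0, X + t • Z ∈ level Ω n := by
  obtain ⟨ε, hε, h⟩ := exists_ncBall_subset_of_isOpen hΩ hX
  have h0 : gnorm 𝕜 (X - X) < ε := by simpa using hε
  filter_upwards [eventually_add_smul_near (Z := Z) h0] with t ht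
  obtain ⟨hn, hmem⟩ := mem_level_ncBall_of_gnorm_lt hX.1 ht
  exact ⟨hn, h hmem⟩

/-- An nc function with a zero at which it is continuous is bounded on an nc ball around it. -/
theorem exists_bounded_ampBall {Ω : Set (NCSpace 𝕜 V)} (hΩ : IsOpen Ω) (hs : 0 < s)
    {P₀ : Matrix (Fin s) (Fin s) V} (h₀ : P₀ ∈ level Ω s) {F : NCMap V W} (hF : F s P₀ = 0)
    (hc : ContinuousWithinAt (NCMap.total 𝕜 F) Ω ⟨s, hs, P₀⟩) :
    ∃ δ > 0, ∀ m > 0, ∀ X ∈ ampBall 𝕜 P₀ δ m,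
      X ∈ level Ω (m * s) ∧ OperatorSpace.mnorm (𝕜 := 𝕜) (m * s) (F (m * s) X) ≤ 1 := by
  have h1 : ncBall 𝕜 (0 : Matrix (Fin s) (Fin s) W) 1 ∈ 𝓝 (NCMap.total 𝕜 F ⟨s, hs, P₀⟩) := by
    refine (isOpen_ncBall hs one_pos).mem_nhds ?_
    have := (self_mem_ncBall (𝕜 := 𝕜) (Y := (0 : Matrix (Fin s) (Fin s) W)) hs one_pos).2
    rw [← hF] at this
    simpa [NCMap.total, hF] using this
  obtain ⟨u, hu, hmem, hsub⟩ := mem_nhdsWithin.1 (hc h1)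
  obtain ⟨δ, hδ, hball⟩ := exists_ncBall_subset_of_isOpen (hu.inter hΩ) (X := P₀) ⟨hs, hmem, h₀.2⟩
  refine ⟨δ, hδ, fun m hm X hX => ?_⟩
  have hp : (⟨m * s, Nat.mul_pos hm hs, X⟩ : NCSpace 𝕜 V) ∈ u ∩ Ω :=
    hball ⟨m, Nat.mul_pos hm hs, X, hX, rfl⟩
  refine ⟨⟨Nat.mul_pos hm hs, hp.2⟩, ?_⟩
  have h2 : F (m * s) X ∈ level (ncBall 𝕜 (0 : Matrix (Fin s) (Fin s) W) 1) (m * s) :=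
    ⟨Nat.mul_pos hm hs, hsub hp⟩
  rw [mem_level_ncBall hs hm] at h2
  have h3 : amp m (0 : Matrix (Fin s) (Fin s) W) = 0 := by
    ext i j
    simp [amp]
  rw [h3, sub_zero, gnorm_fin] at h2
  exact h2.le

/-- An nc function that is bounded on an nc ball gives a local nc family around the
amplifications of the centre. -/
theorem isLocalNC_idxMap {Ω : Set (NCSpace 𝕜 V)} (hΩ : IsNCSet Ω) {F : NCMap V W}
    (hF : IsNCFunction Ω F) {P₀ : Matrix (Fin s) (Fin s) V} {δ M : ℝ} (hδ : 0 < δ) (hM : 0 < M)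
    (h : ∀ m > 0, ∀ X ∈ ampBall 𝕜 P₀ δ m,
      X ∈ level Ω (m * s) ∧ OperatorSpace.mnorm (𝕜 := 𝕜) (m * s) (F (m * s) X) ≤ M) :
    IsLocalNC 𝕜 (IsAmp P₀) (idxMap Ω F) δ M := by
  have key : ∀ {ι : Type} [Fintype ι] {P X : Matrix ι ι V}, IsAmp P₀ ι P →
      gnorm 𝕜 (X - P) < δ → ∃ (m : ℕ) (g : Fin (m * s) ≃ ι), X.submatrix g g ∈ level Ω (m * s) ∧
        OperatorSpace.mnorm (𝕜 := 𝕜) (m * s) (F (m * s) (X.submatrix g g)) ≤ M := by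
    rintro ι _ P X ⟨κ, _, _, e, rfl⟩ hX
    refine ⟨Fintype.card κ, (ampEquiv κ s).trans e.symm, h _ Fintype.card_pos _ ?_⟩
    rw [mem_ampBall, ← gamp_submatrix_ampEquiv]
    rw [← gnorm_reindex 𝕜 ((ampEquiv κ s).trans e.symm)] at hX
    refine lt_of_eq_of_lt (congrArg _ ?_) hX
    ext i j
    simp
  refine ⟨hδ, hM, IsAmp.sum, fun κ _ _ => IsAmp.gamp κ, IsAmp.reindex, ?_, ?_⟩
  · intro ι κ _ _ P X Q Y S hP hQ hX hY hI
    obtain ⟨m, g, hg, -⟩ := key hP hX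
    obtain ⟨m', g', hg', -⟩ := key hQ hY
    exact hF.idxMap_intertwines hΩ ⟨_, g, hg⟩ ⟨_, g', hg'⟩ hI
  · intro ι _ P X hP hX
    obtain ⟨m, g, hg, hb⟩ := key hP hX
    rw [hF.idxMap_eq hΩ g hg, gnorm_eq 𝕜 g]
    simpa [Matrix.submatrix_submatrix] using hb

/-- If a local nc family vanishes at the centre, it vanishes at all amplifications of the centre. -/
theorem IsLocalNC.eq_zero_of_isAmp {P₀ : Matrix (Fin s) (Fin s) V}
    {G : ∀ ι : Type, Matrix ι ι V → Matrix ι ι W} {δ M : ℝ}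
    (hG : IsLocalNC 𝕜 (IsAmp P₀) G δ M) (h0 : G (Fin s) P₀ = 0) {ι : Type} {P : Matrix ι ι V}
    (hP : IsAmp P₀ ι P) : G ι P = 0 := by
  classical
  have hP' := hP
  obtain ⟨κ, _, _, e, rfl⟩ := hP'
  have : Fintype ι := Fintype.ofEquiv _ e.symm
  ext i j
  have hI := hG.intertwines hP isAmp_self (by simp [hG.delta_pos]) (by simp [hG.delta_pos])
    ((intertwines_submatrix_iff e (Equiv.refl (Fin s)) _ _ P₀).2
      (intertwines_blockColumn (𝕜 := 𝕜) P₀ (e j).1)) i (e j).2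
  have h0' : G (Fin s) (P₀.submatrix (Equiv.refl (Fin s)) (Equiv.refl (Fin s))) = 0 := h0
  rw [h0'] at hI
  have he : ∀ k, e k = ((e j).1, (e j).2) ↔ k = j := fun k => e.apply_eq_iff_eq
  simpa [blockColumn, he] using hI

theorem mem_level_of_mem_ampBall {Y : Matrix (Fin s) (Fin s) V} {r : ℝ} {m : ℕ} (hs : 0 < s)
    (hm : 0 < m) {X : Matrix (Fin (m * s)) (Fin (m * s)) V} (hX : X ∈ ampBall 𝕜 Y r m) :
    X ∈ level (ncBall 𝕜 Y r) (m * s) :=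
  (mem_level_ncBall hs hm).2 (mem_ampBall.1 hX)

end Balls

/-! ### Partial derivatives at the amplified centres -/

section PartialDerivatives

variable {𝕜 X Y Z : Type*} [RCLike 𝕜] [AddCommGroup X] [Module 𝕜 X] [OperatorSpace 𝕜 X]
  [AddCommGroup Y] [Module 𝕜 Y] [OperatorSpace 𝕜 Y] [AddCommGroup Z] [Module 𝕜 Z]
  [OperatorSpace 𝕜 Z]

omit [OperatorSpace 𝕜 X] [OperatorSpace 𝕜 Y] in
theorem HasDirDeriv.comp_gpair_left {n : ℕ}
    {g : Matrix (Fin n) (Fin n) (X × Y) → Matrix (Fin n) (Fin n) Z} {x A : Matrix (Fin n) (Fin n) X}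
    {y : Matrix (Fin n) (Fin n) Y} {D : Matrix (Fin n) (Fin n) Z}
    (h : HasDirDeriv 𝕜 g (gpair x y) (inlM 𝕜 X Y _ A) D) :
    HasDirDeriv 𝕜 (fun x' => g (gpair x' y)) x A D := by
  have he : ∀ t : 𝕜, gpair (x + t • A) y = gpair x y + t • inlM 𝕜 X Y _ A := by
    intro t
    ext i j <;> simp [gpair, inlM]
  unfold HasDirDeriv
  simp only [he]
  exact h

omit [OperatorSpace 𝕜 X] [OperatorSpace 𝕜 Y] in
theorem HasDirDeriv.comp_gpair_right {n : ℕ}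
    {g : Matrix (Fin n) (Fin n) (X × Y) → Matrix (Fin n) (Fin n) Z} {x : Matrix (Fin n) (Fin n) X}
    {y B : Matrix (Fin n) (Fin n) Y} {D : Matrix (Fin n) (Fin n) Z}
    (h : HasDirDeriv 𝕜 g (gpair x y) (inrM 𝕜 X Y _ B) D) :
    HasDirDeriv 𝕜 (fun y' => g (gpair x y')) y B D := by
  have he : ∀ t : 𝕜, gpair x (y + t • B) = gpair x y + t • inrM 𝕜 X Y _ B := by
    intro t
    ext i j <;> simp [gpair, inrM]
  unfold HasDirDeriv
  simp only [he]
  exact h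

theorem IsLocalNC.hasDirDeriv_idxMap {V W : Type*} [AddCommGroup V] [Module 𝕜 V]
    [OperatorSpace 𝕜 V] [AddCommGroup W] [Module 𝕜 W] [OperatorSpace 𝕜 W]
    {Ω : Set (NCSpace 𝕜 V)} (hΩ : IsNCSet Ω) (hΩo : IsOpen Ω) {F : NCMap V W}
    (hF : IsNCFunction Ω F) {Good : ∀ ι : Type, Matrix ι ι V → Prop} {δ M : ℝ}
    (hG : IsLocalNC 𝕜 Good (idxMap Ω F) δ M) {n : ℕ} {P R : Matrix (Fin n) (Fin n) V}
    (hP : Good (Fin n) P) (hR : gnorm 𝕜 (R - P) < δ / 4) (hRΩ : R ∈ level Ω n)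
    (A : Matrix (Fin n) (Fin n) V) :
    HasDirDeriv 𝕜 (F n) R A (ncDeriv 𝕜 (idxMap Ω F) δ R A) := by
  refine (hG.hasDirDeriv hP hR A).congr (hF.idxMap_fin hΩ hRΩ) ?_
  filter_upwards [eventually_mem_level hΩo hRΩ A] with t ht
  exact hF.idxMap_fin hΩ ht

theorem IsLocalNC.ncDeriv_amp {V W : Type*} [AddCommGroup V] [Module 𝕜 V]
    [OperatorSpace 𝕜 V] [AddCommGroup W] [Module 𝕜 W] [OperatorSpace 𝕜 W]
    {Good : ∀ ι : Type, Matrix ι ι V → Prop} {G : ∀ ι : Type, Matrix ι ι V → Matrix ι ι W}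
    {δ M : ℝ} (hG : IsLocalNC 𝕜 Good G δ M) {n k : ℕ} (hk : 0 < k)
    {P R : Matrix (Fin n) (Fin n) V} (hP : Good (Fin n) P) (hR : gnorm 𝕜 (R - P) < δ / 4)
    (A : Matrix (Fin (k * n)) (Fin (k * n)) V) :
    ncDeriv 𝕜 G δ (amp k R) A = ampMap k (ncDeriv 𝕜 G δ R) A := by
  have : Nonempty (Fin k) := ⟨⟨0, hk⟩⟩
  have hR' : gnorm 𝕜 (gamp (Fin k) R - gamp (Fin k) P) < δ / 4 := by
    rw [← gamp_sub]
    exact (gnorm_gamp_le 𝕜 _).trans_lt hR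
  have h := hG.ncDeriv_reindex (hG.good_amp (Fin k) hP) hR' finProdFinEquiv.symm
    (A.submatrix finProdFinEquiv finProdFinEquiv)
  rw [← amp_eq_gamp] at h
  have hA : (A.submatrix finProdFinEquiv finProdFinEquiv).submatrix finProdFinEquiv.symm
      finProdFinEquiv.symm = A := by
    ext i j
    simp only [Matrix.submatrix_apply, Equiv.apply_symm_apply]
  rw [hA] at h
  rw [h]
  ext i j
  obtain ⟨⟨p, a⟩, rfl⟩ := finProdFinEquiv.surjective i
  obtain ⟨⟨q, b⟩, rfl⟩ := finProdFinEquiv.surjective j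
  rw [Matrix.submatrix_apply, Equiv.symm_apply_apply, Equiv.symm_apply_apply,
    hG.ncDeriv_gamp hP hR]
  simp [ampMap, block]

/-- Radii for which the contraction argument works. -/
theorem exists_radii {δ K Q : ℝ} (hδ : 0 < δ) (hK : 0 ≤ K) (hQ : 0 ≤ Q) :
    ∃ α β : ℝ, 0 < α ∧ α ≤ β ∧ β ≤ δ / 4 ∧ Q * β ≤ 1 / 2 ∧ 4 * K * α ≤ β := by
  set β := min (δ / 4) (1 / (2 * (Q + 1))) with hβ
  have hβ0 : 0 < β := lt_min (by linarith) (by positivity)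
  refine ⟨β / (4 * K + 1), β, by positivity, div_le_self hβ0.le (by linarith), min_le_left _ _,
    ?_, ?_⟩
  · have h1 : β ≤ 1 / (2 * (Q + 1)) := min_le_right _ _
    rw [le_div_iff₀ (by positivity)] at h1
    nlinarith
  · rw [mul_div_assoc', div_le_iff₀ (by positivity)]
    nlinarith

variable {s : ℕ} {X₀ : Matrix (Fin s) (Fin s) X} {Y₀ : Matrix (Fin s) (Fin s) Y}

/-- At every amplification of the centre, the partial derivative in the second variable is the
amplification of `L`, hence invertible with a bound that does not depend on the size. -/
theorem exists_inverse_of_isAmp {G : ∀ ι : Type, Matrix ι ι (X × Y) → Matrix ι ι Z} {δ M C : ℝ}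
    (hG : IsLocalNC 𝕜 (IsAmp (pair X₀ Y₀)) G δ M)
    {L : Matrix (Fin s) (Fin s) Y ≃ₗ[𝕜] Matrix (Fin s) (Fin s) Z}
    (hL : ∀ B, ncDeriv 𝕜 G δ (pair X₀ Y₀) (inrM 𝕜 X Y _ B) = L B)
    (hC : ∀ k : ℕ, 0 < k → ∀ A : Matrix (Fin (k * s)) (Fin (k * s)) Z,
      gnorm 𝕜 (ampMap k L.symm A) ≤ C * gnorm 𝕜 A)
    {ι : Type} [Fintype ι] {P : Matrix ι ι (X × Y)} (hP : IsAmp (pair X₀ Y₀) ι P) :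
    ∃ Λ : Matrix ι ι Z →ₗ[𝕜] Matrix ι ι Y,
      (∀ B, Λ (ncDeriv 𝕜 G δ P (inrM 𝕜 X Y ι B)) = B) ∧
      (∀ A, ncDeriv 𝕜 G δ P (inrM 𝕜 X Y ι (Λ A)) = A) ∧ ∀ A, gnorm 𝕜 (Λ A) ≤ C * gnorm 𝕜 A := by
  obtain ⟨κ, _, _, e, rfl⟩ := hP
  have hδ := hG.delta_pos
  have hnear : gnorm 𝕜 (pair X₀ Y₀ - pair X₀ Y₀) < δ / 4 := by simp [hδ]
  have hnear' : gnorm 𝕜 (gamp κ (pair X₀ Y₀) - gamp κ (pair X₀ Y₀)) < δ / 4 := by simp [hδ]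
  have hD : ∀ (B : Matrix ι ι Y) (i j : ι),
      ncDeriv 𝕜 G δ ((gamp κ (pair X₀ Y₀)).submatrix e e) (inrM 𝕜 X Y ι B) i j =
      L (Matrix.of fun a b => B (e.symm ((e i).1, a)) (e.symm ((e j).1, b))) (e i).2 (e j).2 := by
    intro B i j
    have h := hG.ncDeriv_reindex (hG.good_amp κ isAmp_self) hnear' e
      ((inrM 𝕜 X Y ι B).submatrix e.symm e.symm)
    have hB : ((inrM 𝕜 X Y ι B).submatrix e.symm e.symm).submatrix e e = inrM 𝕜 X Y ι B := by
      ext i j <;> simp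
    rw [hB] at h
    rw [h, ← hL]
    exact hG.ncDeriv_gamp isAmp_self hnear _ (e i).1 (e j).1 (e i).2 (e j).2
  refine ⟨
    { toFun := fun A => Matrix.of fun i j => L.symm (Matrix.of fun a b =>
        A (e.symm ((e i).1, a)) (e.symm ((e j).1, b))) (e i).2 (e j).2
      map_add' := ?_
      map_smul' := ?_ }, ?_, ?_, ?_⟩
  · intro A A'
    ext i j
    simp only [Matrix.of_apply, Matrix.add_apply]
    rw [← Matrix.add_apply, ← map_add]
    rfl
  · intro c A
    ext i j
    simp only [Matrix.of_apply, Matrix.smul_apply, RingHom.id_apply]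
    rw [← Matrix.smul_apply, ← map_smul]
    rfl
  · intro B
    ext i j
    simp only [LinearMap.coe_mk, AddHom.coe_mk, Matrix.of_apply, hD, Equiv.apply_symm_apply]
    have : (Matrix.of fun a b => L (Matrix.of fun a b => B (e.symm ((e i).1, a))
        (e.symm ((e j).1, b))) a b) = L (Matrix.of fun a b => B (e.symm ((e i).1, a))
        (e.symm ((e j).1, b))) := rfl
    rw [this, LinearEquiv.symm_apply_apply]
    simp
  · intro A
    ext i j
    rw [hD]
    simp only [LinearMap.coe_mk, AddHom.coe_mk, Matrix.of_apply, Equiv.apply_symm_apply]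
    have : (Matrix.of fun a b => L.symm (Matrix.of fun a b => A (e.symm ((e i).1, a))
        (e.symm ((e j).1, b))) a b) = L.symm (Matrix.of fun a b => A (e.symm ((e i).1, a))
        (e.symm ((e j).1, b))) := rfl
    rw [this, LinearEquiv.apply_symm_apply]
    simp
  · intro A
    set g := (ampEquiv κ s).trans e.symm with hg
    have h := hC (Fintype.card κ) Fintype.card_pos (A.submatrix g g)
    rw [gnorm_reindex] at h
    refine le_trans (le_of_eq ?_) h
    rw [← gnorm_reindex 𝕜 g]
    have hb : ∀ p q, block (A.submatrix g g) p q = Matrix.of fun a b =>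
        A (e.symm ((Fintype.equivFin κ).symm p, a)) (e.symm ((Fintype.equivFin κ).symm q, b)) := by
      intro p q
      ext a b
      simp only [block, hg, ampEquiv, Matrix.of_apply, Matrix.submatrix_apply,
        Equiv.trans_apply, Equiv.symm_apply_apply]
      rfl
    congr 1
    ext i j
    obtain ⟨⟨p, a⟩, rfl⟩ := finProdFinEquiv.surjective i
    obtain ⟨⟨q, b⟩, rfl⟩ := finProdFinEquiv.surjective j
    simp only [ampMap, hb, Matrix.reindex_apply, Matrix.submatrix_apply, Equiv.symm_apply_apply,
      Matrix.of_apply]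
    simp [hg, ampEquiv]

end PartialDerivatives

/-! ### The implicit function -/

section ImplicitFunction

variable {𝕜 X Y Z : Type*} [RCLike 𝕜] [AddCommGroup X] [Module 𝕜 X] [OperatorSpace 𝕜 X]
  [AddCommGroup Y] [Module 𝕜 Y] [OperatorSpace 𝕜 Y] [AddCommGroup Z] [Module 𝕜 Z]
  [OperatorSpace 𝕜 Z] {s : ℕ}

variable (𝕜) in
/-- The implicit function: `f(x)` is the zero of `F(x, ·)` in the nc ball of radius `β` around
`Y₀` (and `0` where there is none). -/
def implicitFun (F : NCMap (X × Y) Z) (Y₀ : Matrix (Fin s) (Fin s) Y) (β : ℝ) : NCMap X Y :=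
  fun n x => open Classical in
    if h : ∃ y, y ∈ level (ncBall 𝕜 Y₀ β) n ∧ F n (pair x y) = 0 then h.choose else 0

omit [OperatorSpace 𝕜 X] [OperatorSpace 𝕜 Y] in
theorem intertwines_gpair {ι κ : Type} [Fintype ι] [Fintype κ] {A : Matrix ι ι X}
    {B : Matrix ι ι Y} {A' : Matrix κ κ X} {B' : Matrix κ κ Y} {S : Matrix ι κ 𝕜}
    (hA : Intertwines A S A') (hB : Intertwines B S B') :
    Intertwines (gpair A B) S (gpair A' B') := by
  intro i j
  refine Prod.ext ?_ ?_
  · simpa [Prod.fst_sum, gpair] using hA i j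
  · simpa [Prod.snd_sum, gpair] using hB i j

variable {Ω : Set (NCSpace 𝕜 (X × Y))} {F : NCMap (X × Y) Z}
  {X₀ : Matrix (Fin s) (Fin s) X} {Y₀ : Matrix (Fin s) (Fin s) Y} {δ M C α β : ℝ}

theorem isAmp_gpair {m : ℕ} (hm : 0 < m) :
    IsAmp (pair X₀ Y₀) (Fin (m * s)) (gpair (amp m X₀) (amp m Y₀)) := by
  rw [pair_amp]
  exact isAmp_amp hm

namespace IsImplicitData

variable (h : IsImplicitData 𝕜 (IsAmp (pair X₀ Y₀)) (idxMap Ω F) δ M C α β)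
  (hΩ : IsNCSet Ω) (hF : IsNCFunction Ω F) (hs : 0 < s)
  (hball : ∀ m > 0, ∀ R ∈ ampBall 𝕜 (pair X₀ Y₀) δ m, R ∈ level Ω (m * s))

include h hs hball

theorem pair_mem_level {n : ℕ} {x : Matrix (Fin n) (Fin n) X} {y : Matrix (Fin n) (Fin n) Y}
    (hx : x ∈ level (ncBall 𝕜 X₀ α) n) (hy : y ∈ level (ncBall 𝕜 Y₀ β) n) :
    pair x y ∈ level Ω n := by
  obtain ⟨m, hm, -, rfl⟩ := exists_of_mem_level_ncBall hx
  rw [mem_level_ncBall hs hm] at hx hy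
  refine hball m hm _ (mem_ampBall.2 ?_)
  rw [← pair_amp]
  exact (h.gpair_near hx hy).trans_le (h.beta_le.trans (by linarith [h.delta_pos]))

include hΩ hF

theorem idxMap_pair {n : ℕ} {x : Matrix (Fin n) (Fin n) X} {y : Matrix (Fin n) (Fin n) Y}
    (hx : x ∈ level (ncBall 𝕜 X₀ α) n) (hy : y ∈ level (ncBall 𝕜 Y₀ β) n) :
    idxMap Ω F (Fin n) (gpair x y) = F n (pair x y) :=
  hF.idxMap_fin hΩ (h.pair_mem_level hs hball hx hy)

theorem implicitFun_spec {n : ℕ} {x : Matrix (Fin n) (Fin n) X}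
    (hx : x ∈ level (ncBall 𝕜 X₀ α) n) :
    implicitFun 𝕜 F Y₀ β n x ∈ level (ncBall 𝕜 Y₀ β) n ∧
      F n (pair x (implicitFun 𝕜 F Y₀ β n x)) = 0 := by
  have hex : ∃ y, y ∈ level (ncBall 𝕜 Y₀ β) n ∧ F n (pair x y) = 0 := by
    have hx' := hx
    obtain ⟨m, hm, -, rfl⟩ := exists_of_mem_level_ncBall hx
    rw [mem_level_ncBall hs hm] at hx
    obtain ⟨y, hy, hy0⟩ := h.exists_zero (isAmp_gpair hm) hx
    rw [← mem_level_ncBall hs hm] at hy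
    exact ⟨y, hy, by rw [← h.idxMap_pair hΩ hF hs hball hx' hy, hy0]⟩
  rw [implicitFun, dif_pos hex]
  exact hex.choose_spec

theorem eq_implicitFun {n : ℕ} {x : Matrix (Fin n) (Fin n) X} {y : Matrix (Fin n) (Fin n) Y}
    (hx : x ∈ level (ncBall 𝕜 X₀ α) n) (hy : y ∈ level (ncBall 𝕜 Y₀ β) n)
    (h0 : F n (pair x y) = 0) : y = implicitFun 𝕜 F Y₀ β n x := by
  obtain ⟨hy', h0'⟩ := h.implicitFun_spec hΩ hF hs hball hx
  rw [← h.idxMap_pair hΩ hF hs hball hx hy] at h0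
  rw [← h.idxMap_pair hΩ hF hs hball hx hy'] at h0'
  obtain ⟨m, hm, -, rfl⟩ := exists_of_mem_level_ncBall hx
  rw [mem_level_ncBall hs hm] at hx hy hy'
  exact h.unique (isAmp_gpair hm) hx hy hy' h0 h0'

/-- The implicit function respects intertwinings: if `x q = q x'`, then for small `c` the matrix
`[[f(x), c (q f(x') - f(x) q)], [0, f(x')]]` solves the equation at `x ⊕ x'`, as does
`f(x) ⊕ f(x')`, so the two agree. -/
theorem implicitFun_intertwines {n : ℕ} {x x' : Matrix (Fin n) (Fin n) X}
    (hx : x ∈ level (ncBall 𝕜 X₀ α) n) (hx' : x' ∈ level (ncBall 𝕜 X₀ α) n)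
    {q : Matrix (Fin n) (Fin n) 𝕜} (hq : Intertwines x q x') :
    Intertwines (implicitFun 𝕜 F Y₀ β n x) q (implicitFun 𝕜 F Y₀ β n x') := by
  obtain ⟨hy, h0⟩ := h.implicitFun_spec hΩ hF hs hball hx
  obtain ⟨hy', h0'⟩ := h.implicitFun_spec hΩ hF hs hball hx'
  rw [← h.idxMap_pair hΩ hF hs hball hx hy] at h0
  rw [← h.idxMap_pair hΩ hF hs hball hx' hy'] at h0'
  set y := implicitFun 𝕜 F Y₀ β n x
  set y' := implicitFun 𝕜 F Y₀ β n x'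
  obtain ⟨m, hm, -, rfl⟩ := exists_of_mem_level_ncBall hx
  rw [mem_level_ncBall hs hm] at hx hy hx' hy'
  have hP := isAmp_gpair (X₀ := X₀) (Y₀ := Y₀) hm
  have hPP : IsAmp (pair X₀ Y₀) (Fin (m * s) ⊕ Fin (m * s))
      (gpair (Matrix.fromBlocks (amp m X₀) 0 0 (amp m X₀))
        (Matrix.fromBlocks (amp m Y₀) 0 0 (amp m Y₀))) := by
    convert hP.sum hP using 1
    ext (i | i) (j | j) <;> rfl
  set w : Matrix (Fin (m * s)) (Fin (m * s)) Y :=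
    Matrix.of fun i j => ∑ k, q i k • y' k j - ∑ k, q k j • y i k with hw
  have hX : gnorm 𝕜 (Matrix.fromBlocks x 0 0 x' -
      Matrix.fromBlocks (amp m X₀) 0 0 (amp m X₀)) < α := by
    have : Matrix.fromBlocks x 0 0 x' - Matrix.fromBlocks (amp m X₀) 0 0 (amp m X₀) =
        Matrix.fromBlocks (x - amp m X₀) 0 0 (x' - amp m X₀) := by
      ext (i | i) (j | j) <;> simp
    rw [this, gnorm_fromBlocks_diag]
    exact max_lt hx hx'
  have hmax : max (gnorm 𝕜 (y - amp m Y₀)) (gnorm 𝕜 (y' - amp m Y₀)) < β := max_lt hy hy'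
  set μ := (max (gnorm 𝕜 (y - amp m Y₀)) (gnorm 𝕜 (y' - amp m Y₀)) + β) / 2 with hμ
  have hYc : ∀ c : 𝕜, gnorm 𝕜 (c • w) ≤ β - μ → gnorm 𝕜 (Matrix.fromBlocks y (c • w) 0 y' -
      Matrix.fromBlocks (amp m Y₀) 0 0 (amp m Y₀)) < β := by
    intro c hc
    have h1 : gnorm 𝕜 (y - amp m Y₀) < μ := by
      have := le_max_left (gnorm 𝕜 (y - amp m Y₀)) (gnorm 𝕜 (y' - amp m Y₀))
      rw [hμ]; linarith
    have h2 : gnorm 𝕜 (y' - amp m Y₀) < μ := by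
      have := le_max_right (gnorm 𝕜 (y - amp m Y₀)) (gnorm 𝕜 (y' - amp m Y₀))
      rw [hμ]; linarith
    exact (gnorm_tri_sub_lt h1 h2 hc).trans_le (by linarith)
  have hβδ : β ≤ δ := h.beta_le.trans (by linarith [h.delta_pos])
  have hzero : ∀ c : 𝕜, gnorm 𝕜 (c • w) ≤ β - μ → idxMap Ω F (Fin (m * s) ⊕ Fin (m * s))
      (gpair (Matrix.fromBlocks x 0 0 x') (Matrix.fromBlocks y (c • w) 0 y')) = 0 := by
    intro c hc
    have hnear := (h.gpair_near hX (hYc c hc)).trans_le hβδ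
    -- the two columns of `[[1, c q], [0, 1]]` are intertwinings with the diagonal blocks
    have I1 := h.intertwines (S := Matrix.of fun (i : Fin (m * s) ⊕ Fin (m * s)) j =>
      Sum.elim (fun i => if i = j then (1 : 𝕜) else 0) (fun _ => 0) i) hPP hP hnear
      ((h.gpair_near hx hy).trans_le hβδ)
      (intertwines_gpair (by rintro (i | i) j <;> simp) (by rintro (i | i) j <;> simp))
    have I2 := h.intertwines (S := Matrix.of fun (i : Fin (m * s) ⊕ Fin (m * s)) j =>
      Sum.elim (fun i => c * q i j) (fun i => if i = j then (1 : 𝕜) else 0) i) hPP hP hnear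
      ((h.gpair_near hx' hy').trans_le hβδ)
      (intertwines_gpair
        (by
          rintro (i | i) j
          · simpa [mul_smul, Finset.smul_sum] using congrArg (c • ·) (hq i j)
          · simp)
        (by
          rintro (i | i) j
          · simp [hw, mul_smul, ← Finset.smul_sum, smul_sub]
          · simp))
    rw [h0] at I1
    rw [h0'] at I2
    have hl : ∀ i j, idxMap Ω F (Fin (m * s) ⊕ Fin (m * s))
        (gpair (Matrix.fromBlocks x 0 0 x') (Matrix.fromBlocks y (c • w) 0 y')) i (Sum.inl j) =
        0 := by
      intro i j
      simpa using I1 i j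
    ext i (j | j)
    · exact hl i j
    · simpa [hl] using I2 i j
  obtain ⟨c, hc, hcw⟩ := exists_smul_gnorm_le (𝕜 := 𝕜) w (r := β - μ) (by rw [hμ]; linarith)
  have h1 := hcw c hc.le le_rfl
  have h2 : gnorm 𝕜 ((0 : 𝕜) • w) ≤ β - μ := by rw [zero_smul, map_zero, hμ]; linarith
  have huniq := h.unique hPP hX (hYc _ h1) (hYc _ h2) (hzero _ h1) (hzero _ h2)
  have hw0 : w = 0 := by
    have h3 := congrArg Matrix.toBlocks₁₂ huniq
    rw [Matrix.toBlocks_fromBlocks₁₂, Matrix.toBlocks_fromBlocks₁₂, zero_smul] at h3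
    exact (smul_eq_zero.1 h3).resolve_left (RCLike.ofReal_ne_zero.2 hc.ne')
  intro i j
  exact (sub_eq_zero.1 (congrFun (congrFun hw0 i) j)).symm

theorem isNCFunction_implicitFun :
    IsNCFunction (ncBall 𝕜 X₀ α) (implicitFun 𝕜 F Y₀ β : NCMap X Y) where
  map_dsum n n' x hx x' hx' := by
    obtain ⟨hy, h0⟩ := h.implicitFun_spec hΩ hF hs hball hx
    obtain ⟨hy', h0'⟩ := h.implicitFun_spec hΩ hF hs hball hx'
    refine (h.eq_implicitFun hΩ hF hs hball (isNCSet_ncBall X₀ α n n' x hx x' hx')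
      (isNCSet_ncBall Y₀ β n n' _ hy _ hy') ?_).symm
    have hp : ∀ (y : Matrix (Fin n) (Fin n) Y) (y' : Matrix (Fin n') (Fin n') Y),
        pair (dsum x x') (dsum y y') = dsum (pair x y) (pair x' y') := by
      intro y y'
      ext i j <;>
      refine Fin.addCases (fun i => ?_) (fun i => ?_) i <;>
        refine Fin.addCases (fun j => ?_) (fun j => ?_) j <;> simp [dsum, pair]
    rw [hp, hF.map_dsum n n' _ (h.pair_mem_level hs hball hx hy) _
      (h.pair_mem_level hs hball hx' hy'), h0, h0']
    ext i j
    refine Fin.addCases (fun i => ?_) (fun i => ?_) i <;>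
        refine Fin.addCases (fun j => ?_) (fun j => ?_) j <;> simp [dsum]
  map_similar n x hx S hx' := by
    refine (rmul_inv_eq_iff S _ _).2 ?_ |>.symm
    refine ((intertwines_iff _ _ _).1 (h.implicitFun_intertwines hΩ hF hs hball hx' hx ?_)).symm
    exact (intertwines_iff _ _ _).2 ((rmul_inv_eq_iff S _ _).1 rfl).symm

theorem uniformlyLocallyBounded_implicitFun :
    UniformlyLocallyBounded (ncBall 𝕜 X₀ α) (implicitFun 𝕜 F Y₀ β : NCMap X Y) := by
  intro n x hx
  obtain ⟨r, hr, hsub⟩ := exists_ncBall_subset_ncBall hx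
  refine ⟨r, hr, hsub, β + gnorm 𝕜 Y₀, fun k hk x' hx' => ?_⟩
  have hkn := Nat.mul_pos hk hx.1
  obtain ⟨hy, -⟩ := h.implicitFun_spec hΩ hF hs hball ⟨hkn, hsub ⟨k, hkn, x', hx', rfl⟩⟩
  obtain ⟨m, hm, -, hmn⟩ := exists_of_mem_level_ncBall hy
  rw [← gnorm_fin]
  generalize implicitFun 𝕜 F Y₀ β (k * n) x' = y at hy ⊢
  generalize k * n = N at y hy hmn
  subst hmn
  rw [mem_level_ncBall hs hm] at hy
  have h1 := map_add_le_add (gnorm 𝕜) (y - amp m Y₀) (amp m Y₀)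
  rw [sub_add_cancel] at h1
  linarith [gnorm_amp_le (𝕜 := 𝕜) m Y₀]

/-- The derivatives of `F` and of the implicit function at a point of the graph. -/
theorem exists_derivatives (hΩo : IsOpen Ω) {n : ℕ} {x : Matrix (Fin n) (Fin n) X}
    (hx : x ∈ level (ncBall 𝕜 X₀ α) n) :
    ∃ (A : Matrix (Fin n) (Fin n) X →ₗ[𝕜] Matrix (Fin n) (Fin n) Z)
      (B : Matrix (Fin n) (Fin n) Y ≃ₗ[𝕜] Matrix (Fin n) (Fin n) Z),
      IsGDeriv (fun x' => F n (pair x' (implicitFun 𝕜 F Y₀ β n x))) x A ∧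
      IsGDeriv (fun y' => F n (pair x y')) (implicitFun 𝕜 F Y₀ β n x) B.toLinearMap ∧
      IsCompletelyBounded 𝕜 B.toLinearMap ∧
      IsCompletelyBounded 𝕜 B.symm.toLinearMap ∧
      IsGDeriv (implicitFun 𝕜 F Y₀ β n) x (-(B.symm.toLinearMap ∘ₗ A)) := by
  have hopen := isOpen_ncBall (𝕜 := 𝕜) (Y := X₀) hs h.alpha_pos
  have hxl := hx
  obtain ⟨hyl, h0⟩ := h.implicitFun_spec hΩ hF hs hball hx
  have hRΩ := h.pair_mem_level hs hball hxl hyl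
  rw [← h.idxMap_pair hΩ hF hs hball hx hyl] at h0
  obtain ⟨m, hm, -, rfl⟩ := exists_of_mem_level_ncBall hx
  have hy := hyl
  rw [mem_level_ncBall hs hm] at hx hy
  have hP := isAmp_gpair (X₀ := X₀) (Y₀ := Y₀) hm
  have hR := h.gpair_near hx hy
  obtain ⟨B, hB⟩ := h.exists_partial_equiv hP hR
  set y := implicitFun 𝕜 F Y₀ β (m * s) x
  have hFd := h.hasDirDeriv_idxMap hΩ hΩo hF hP (hR.trans_le h.beta_le) hRΩ
  -- amplifications of the point and of the centre
  have hRk : ∀ k : ℕ, gnorm 𝕜 (amp k (gpair x y) -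
      gpair (amp k (amp m X₀)) (amp k (amp m Y₀))) < β := by
    intro k
    have : gpair (amp k (amp m X₀)) (amp k (amp m Y₀)) =
      amp k (gpair (amp m X₀) (amp m Y₀)) := pair_amp _ _
    rw [this, ← amp_sub]
    exact (gnorm_amp_le k _).trans_lt hR
  have hPk : ∀ k : ℕ, 0 < k → IsAmp (pair X₀ Y₀) (Fin (k * (m * s)))
      (gpair (amp k (amp m X₀)) (amp k (amp m Y₀))) := by
    intro k hk
    have : Nonempty (Fin k) := ⟨⟨0, hk⟩⟩
    have e : gpair (amp k (amp m X₀)) (amp k (amp m Y₀)) =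
      amp k (gpair (amp m X₀) (amp m Y₀)) := pair_amp _ _
    rw [e, amp_eq_gamp]
    exact (hP.gamp (Fin k)).reindex _
  have hBk : ∀ k : ℕ, 0 < k → ∀ b : Matrix (Fin (k * (m * s))) (Fin (k * (m * s))) Y,
      ampMap k B.toLinearMap b =
        ncDeriv 𝕜 (idxMap Ω F) δ (amp k (gpair x y)) (inrM 𝕜 X Y _ b) := by
    intro k hk b
    rw [h.ncDeriv_amp hk hP (hR.trans_le h.beta_le), hB]
    rfl
  refine ⟨ncDeriv 𝕜 (idxMap Ω F) δ (gpair x y) ∘ₗ inlM 𝕜 X Y _, B, ?_, ?_, ?_, ?_, ?_⟩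
  · exact fun a => (hFd (inlM 𝕜 X Y _ a)).comp_gpair_left
  · rw [hB]
    exact fun b => (hFd (inrM 𝕜 X Y _ b)).comp_gpair_right
  · refine ⟨4 * M / δ, fun k hk b => ?_⟩
    rw [← gnorm_fin, ← gnorm_fin, hBk k hk, ← gnorm_inrM (X := X) b]
    exact h.gnorm_ncDeriv_le (hPk k hk) ((hRk k).trans_le h.beta_le) _
  · refine ⟨2 * C, fun k hk a => ?_⟩
    rw [← gnorm_fin, ← gnorm_fin]
    have h1 := h.gnorm_le_ncDeriv (hPk k hk) (hRk k) (ampMap k B.symm.toLinearMap a)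
    rw [← hBk k hk] at h1
    have h2 : ampMap k B.toLinearMap (ampMap k B.symm.toLinearMap a) = a := by
      have hb : ∀ p q, block (ampMap k B.symm.toLinearMap a) p q = B.symm (block a p q) := by
        intro p q
        ext i j
        simp only [block, ampMap, Matrix.reindex_apply, Matrix.submatrix_apply, Matrix.of_apply,
          Equiv.symm_apply_apply]
        rfl
      ext i j
      obtain ⟨⟨p, i⟩, rfl⟩ := finProdFinEquiv.surjective i
      obtain ⟨⟨q, j⟩, rfl⟩ := finProdFinEquiv.surjective j
      rw [ampMap]
      simp only [hb, Matrix.reindex_apply, Matrix.submatrix_apply, Matrix.of_apply,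
        Equiv.symm_apply_apply]
      have := B.apply_symm_apply (block a p q)
      exact congrFun (congrFun this i) j
    rwa [h2] at h1
  · intro a
    refine hasDirDeriv_of_quadratic
      (E := 2 * C * (8 * M / δ ^ 2) * max 1 (2 * C * (2 * M / δ)) ^ 2) ?_
    filter_upwards [eventually_mem_level hopen hxl a] with t ht
    obtain ⟨hyt, h0t⟩ := h.implicitFun_spec hΩ hF hs hball ht
    rw [← h.idxMap_pair hΩ hF hs hball ht hyt] at h0t
    rw [mem_level_ncBall hs hm] at ht hyt
    have hq := h.gnorm_implicit_deriv_le hP hx ht hy hyt h0 h0t hB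
    rw [add_sub_cancel_left] at hq
    refine le_trans (le_of_eq ?_) hq
    congr 1
    simp [sub_eq_add_neg]
    rfl

end IsImplicitData

end ImplicitFunction

end NCFun

end

open NCFun in
theorem mainTheorem1 {𝕜 : Type*} [RCLike 𝕜] {𝒳 𝒴 𝒵 : Type*}
    [AddCommGroup 𝒳] [Module 𝕜 𝒳] [OperatorSpace 𝕜 𝒳]
    [AddCommGroup 𝒴] [Module 𝕜 𝒴] [OperatorSpace 𝕜 𝒴]
    [AddCommGroup 𝒵] [Module 𝕜 𝒵] [OperatorSpace 𝕜 𝒵]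
    (Ω : Set (NCSpace 𝕜 (𝒳 × 𝒴))) (hΩ_nc : IsNCSet Ω) (hΩ_open : IsOpen Ω)
    (s : ℕ) (hs : 0 < s)
    (X₀ : Matrix (Fin s) (Fin s) 𝒳) (Y₀ : Matrix (Fin s) (Fin s) 𝒴)
    (h₀ : pair X₀ Y₀ ∈ level Ω s)
    (F : NCMap (𝒳 × 𝒴) 𝒵) (hF : IsNCFunction Ω F)
    (hF_zero : F s (pair X₀ Y₀) = 0)
    (hF_cont : ContinuousWithinAt (NCMap.total 𝕜 F) Ω ⟨s, hs, pair X₀ Y₀⟩)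
    (L : Matrix (Fin s) (Fin s) 𝒴 ≃ₗ[𝕜] Matrix (Fin s) (Fin s) 𝒵)
    (hL : IsGDeriv (fun Y => F s (pair X₀ Y)) Y₀ L.toLinearMap)
    (hL_cb : IsCompletelyBounded 𝕜 L.toLinearMap)
    (hL_inv : IsCompletelyBounded 𝕜 L.symm.toLinearMap) :
    ∃ α > 0, ∃ β > 0,
      (∀ m > 0, ∀ X ∈ ampBall 𝕜 X₀ α m, ∀ Y ∈ ampBall 𝕜 Y₀ β m, pair X Y ∈ level Ω (m * s)) ∧
      ∃ f : NCMap 𝒳 𝒴,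
        IsNCFunction (ncBall 𝕜 X₀ α) f ∧
        Set.MapsTo (NCMap.total 𝕜 f) (ncBall 𝕜 X₀ α) (ncBall 𝕜 Y₀ β) ∧
        (∀ m > 0, ∀ X ∈ ampBall 𝕜 X₀ α m, ∀ Y ∈ ampBall 𝕜 Y₀ β m,
          F (m * s) (pair X Y) = 0 ↔ Y = f (m * s) X) ∧
        UniformlyAnalytic (ncBall 𝕜 X₀ α) f ∧
        ∀ (n : ℕ), ∀ X ∈ level (ncBall 𝕜 X₀ α) n,
          ∃ (A : Matrix (Fin n) (Fin n) 𝒳 →ₗ[𝕜] Matrix (Fin n) (Fin n) 𝒵)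
            (B : Matrix (Fin n) (Fin n) 𝒴 ≃ₗ[𝕜] Matrix (Fin n) (Fin n) 𝒵),
            IsGDeriv (fun X' => F n (pair X' (f n X))) X A ∧
            IsGDeriv (fun Y' => F n (pair X Y')) (f n X) B.toLinearMap ∧
            IsCompletelyBounded 𝕜 B.toLinearMap ∧
            IsCompletelyBounded 𝕜 B.symm.toLinearMap ∧
            IsGDeriv (f n) X (-(B.symm.toLinearMap ∘ₗ A)) := by
  obtain ⟨δ, hδ, hball⟩ := exists_bounded_ampBall hΩ_open hs h₀ hF_zero hF_cont
  have hG := isLocalNC_idxMap hΩ_nc hF hδ one_pos hball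
  obtain ⟨C, hC⟩ := hL_inv
  have hnear : gnorm 𝕜 (pair X₀ Y₀ - pair X₀ Y₀) < δ / 4 := by simp [hδ]
  have hLD : ∀ B, ncDeriv 𝕜 (idxMap Ω F) δ (pair X₀ Y₀) (inrM 𝕜 𝒳 𝒴 _ B) = L B := fun B =>
    (HasDirDeriv.comp_gpair_right
      (hG.hasDirDeriv_idxMap hΩ_nc hΩ_open hF isAmp_self hnear h₀ _)).unique (hL B)
  obtain ⟨α, β, hα, hαβ, hβδ, hβ, hαs⟩ := exists_radii (K := max C 0 * (2 * 1 / δ))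
    (Q := max C 0 * (8 * 1 / δ ^ 2)) hδ (by positivity) (by positivity)
  have h : IsImplicitData 𝕜 (IsAmp (pair X₀ Y₀)) (idxMap Ω F) δ 1 (max C 0) α β :=
    { hG with
      C_nonneg := le_max_right _ _
      map_center := hG.eq_zero_of_isAmp (by rw [hF.idxMap_fin hΩ_nc h₀, hF_zero])
      inverse := fun hP => exists_inverse_of_isAmp hG hLD (fun k hk A => by
        rw [gnorm_fin, gnorm_fin]
        refine (hC k hk A).trans ?_
        exact mul_le_mul_of_nonneg_right (le_max_left _ _) (apply_nonneg _ _)) hP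
      alpha_pos := hα
      alpha_le := hαβ
      beta_le := hβδ
      beta_small := by rw [← mul_assoc]; exact hβ
      alpha_small := hαs }
  have hb : ∀ m > 0, ∀ R ∈ ampBall 𝕜 (pair X₀ Y₀) δ m, R ∈ level Ω (m * s) :=
    fun m hm R hR => (hball m hm R hR).1
  have hspec := fun {n : ℕ} {x : Matrix (Fin n) (Fin n) 𝒳} =>
    h.implicitFun_spec hΩ_nc hF hs hb (n := n) (x := x)
  refine ⟨α, hα, β, h.beta_pos, fun m hm x hx y hy =>
    h.pair_mem_level hs hb (mem_level_of_mem_ampBall hs hm hx) (mem_level_of_mem_ampBall hs hm hy),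
    implicitFun 𝕜 F Y₀ β, h.isNCFunction_implicitFun hΩ_nc hF hs hb, ?_, ?_,
    ⟨h.isNCFunction_implicitFun hΩ_nc hF hs hb,
      h.uniformlyLocallyBounded_implicitFun hΩ_nc hF hs hb, ?_⟩,
    fun n x hx => h.exists_derivatives hΩ_nc hF hs hb hΩ_open hx⟩
  · rintro ⟨n, hn, x⟩ hx
    exact (hspec (n := n) ⟨hn, hx⟩).1.2
  · intro m hm x hx y hy
    have hx' := mem_level_of_mem_ampBall hs hm hx
    refine ⟨h.eq_implicitFun hΩ_nc hF hs hb hx' (mem_level_of_mem_ampBall hs hm hy), ?_⟩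
    rintro rfl
    exact (hspec hx').2
  · intro n x hx a
    obtain ⟨A, B, -, -, -, -, hd⟩ := h.exists_derivatives hΩ_nc hF hs hb hΩ_open hx
    exact ⟨_, hd a⟩
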